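/- **Setting.** Let $d\ge 1$, let $\Omega\subset\mathbb R^d$ be a non-empty bounded open set (for instance a bounded domain with smooth boundary), let $\alpha\in(0,1)$ and let $\eta\in\mathbb R^d$ be a constant vector. A *Dirichlet eigensystem* of $\Omega$ is a complete orthonormal system $\{\phi_k\}_{k\in\mathbb N}$ of $L^2(\Omega)$ together with numbers $\theta_k>0$ (listed in any order) such that $\phi_k\in W_0^{1,2}(\Omega)$ and $-\Delta\phi_k=\theta_k\phi_k$ weakly, i.e. $\int_\Omega\nabla\phi_k\cdot\nabla v=\theta_k\int_\Omega\phi_k v$ for all $v\in C_c^\infty(\Omega)$. Given such a system, put, with $\langle\cdot,\cdot\rangle$ the scalar product of $L^2(\Omega)$, $$D^1(\Omega)=\Big\{w\in L^2(\Omega):\ \|w\|_{D^1(\Omega)}^2=\sum_k\theta_k\langle w,\phi_k\rangle^2<\infty\Big\},\qquad E_{a,b}(z)=\sum_{n=0}^\infty\frac{z^n}{\Gamma(an+b)},$$ $$\mathscr S(t)w=\sum_k E_{\alpha,1}\Big(\frac{-\theta_kt^\alpha}{1+\theta_k}\Big)\langle w,\phi_k\rangle\phi_k,\qquad \mathscr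 R(t)w=\sum_k\frac{t^{\alpha-1}}{1+\theta_k}E_{\alpha,\alpha}\Big(\frac{-\theta_kt^\alpha}{1+\theta_k}\Big)\langle w,\phi_k\rangle\phi_k,$$ and let $H(w)=(\eta\cdot\nabla)w$, where $\nabla$ is the weak gradient. For $T>0$ and $u_0\in D^1(\Omega)$, a *mild solution* on $[0,T]$ of the problem $$\partial_t^\alpha u-\partial_t^\alpha\Delta u-\Delta u=H(u)\ \text{in }\Omega\times(0,T],\qquad u=0\ \text{on }\partial\Omega,\qquad u(0)=u_0$$ ($\partial_t^\alpha$ the Caputo derivative of order $\alpha$) is a function $u\in C([0,T]\to D^1(\Omega))$ with $u(0)=u_0$ and $$u(t)=\mathscr S(t)u_0+\int_0^t\mathscr R(t-\tau)H(u(\tau))\,d\tau\qquad(0\le t\le T),$$ the integral being a (convergent) Bochner integral in $L^2(\Omega)$. For $\sigma>0$ let $\mathbb Y(\alpha,\sigma)$ be the set of all $w\in C([0,T]\to D^1(\Omega))$ with $w(0)=u_0$ and $\sup_{0<t\le T}t^\alpha e^{-\sigma t}\|w(t)\|_{D^1(\Omega)}<\infty$. **Theorem (Global existence).** A Dirichlet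 eigensystem of $\Omega$ exists, and for every Dirichlet eigensystem the following holds. 1. Every $w\in D^1(\Omega)$ has a weak gradient in $L^2(\Omega)^d$, and $H$ is globally Lipschitz from $D^1(\Omega)$ to $L^2(\Omega)$: there is a constant $C>0$ with $\|H(w)-H(v)\|_{L^2(\Omega)}\le C\|w-v\|_{D^1(\Omega)}$ for all $w,v\in D^1(\Omega)$. 2. For every $u_0\in D^1(\Omega)$ (of any size) and every $T>0$ the problem has at least one mild solution $u\in C([0,T]\to D^1(\Omega))$. Moreover, $u$ can be taken so that, for some $\sigma>0$, the Picard iterates $$w_1(t)=\mathscr S(t)u_0,\qquad w_{n+1}(t)=\mathscr S(t)u_0+\int_0^t\mathscr R(t-\tau)H(w_n(\tau))\,d\tau$$ and $u$ all belong to $\mathbb Y(\alpha,\sigma)$, and $\sup_{0<t\le T}t^\alpha e^{-\sigma t}\|w_n(t)-u(t)\|_{D^1(\Omega)}\to0$ as $n\to\infty$. -/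

import Mathlib

open MeasureTheory Filter Topology Set
open scoped ContDiff

noncomputable section

namespace PseudoParabolic

/-- The real Hilbert space `L²(Ω)` for a set `Ω ⊆ ℝ^d`. -/
abbrev L2 {d : ℕ} (Ω : Set (EuclideanSpace ℝ (Fin d))) : Type :=
  Lp ℝ 2 ((volume : Measure (EuclideanSpace ℝ (Fin d))).restrict Ω)

/-- The classical partial derivative `∂_j v`. -/
def partialDeriv {d : ℕ} (j : Fin d) (v : EuclideanSpace ℝ (Fin d) → ℝ)
    (x : EuclideanSpace ℝ (Fin d)) : ℝ :=
  fderiv ℝ v x (EuclideanSpace.single j 1)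

/-- `v ∈ C_c^∞(Ω)`. -/
structure IsTestFunction {d : ℕ} (Ω : Set (EuclideanSpace ℝ (Fin d)))
    (v : EuclideanSpace ℝ (Fin d) → ℝ) : Prop where
  smooth : ContDiff ℝ ∞ v
  compact : HasCompactSupport v
  support : tsupport v ⊆ Ω

/-- `g = (g_1, …, g_d) ∈ L²(Ω)^d` is the weak gradient of `w` in `Ω`. -/
def IsWeakGradient {d : ℕ} (Ω : Set (EuclideanSpace ℝ (Fin d)))
    (w : L2 Ω) (g : Fin d → L2 Ω) : Prop :=
  ∀ v : EuclideanSpace ℝ (Fin d) → ℝ, IsTestFunction Ω v → ∀ j : Fin d,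
    ∫ x in Ω, w x * partialDeriv j v x = - ∫ x in Ω, g j x * v x

/-- `w` belongs to `W^{1,2}(Ω)`: it has a weak gradient in `L²(Ω)^d`. -/
def HasWeakGradient {d : ℕ} (Ω : Set (EuclideanSpace ℝ (Fin d))) (w : L2 Ω) : Prop :=
  ∃ g : Fin d → L2 Ω, IsWeakGradient Ω w g

open Classical in
/-- The weak gradient of `w`, if there is one (it is unique when `Ω` is open); else `0`. -/
def weakGradient {d : ℕ} (Ω : Set (EuclideanSpace ℝ (Fin d))) (w : L2 Ω) : Fin d → L2 Ω :=
  if h : HasWeakGradient Ω w then h.choose else 0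

/-- `w ∈ W_0^{1,2}(Ω)`, the closure of `C_c^∞(Ω)` in `W^{1,2}(Ω)`. -/
def MemW012 {d : ℕ} (Ω : Set (EuclideanSpace ℝ (Fin d))) (w : L2 Ω) : Prop :=
  HasWeakGradient Ω w ∧
    ∃ v : ℕ → EuclideanSpace ℝ (Fin d) → ℝ, (∀ n, IsTestFunction Ω (v n)) ∧
      Tendsto (fun n => eLpNorm (fun x => v n x - w x) 2 (volume.restrict Ω)) atTop (𝓝 0) ∧
      ∀ j, Tendsto (fun n => eLpNorm (fun x => partialDeriv j (v n) x - weakGradient Ω w j x) 2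
        (volume.restrict Ω)) atTop (𝓝 0)

/-- `f` is an eigenfunction of the Dirichlet Laplacian `-Δ` on `Ω` with eigenvalue `l`
(weak form of `-Δ f = l f` in `Ω`, `f = 0` on `∂Ω`). -/
structure IsDirichletEigenfunction {d : ℕ} (Ω : Set (EuclideanSpace ℝ (Fin d)))
    (l : ℝ) (f : L2 Ω) : Prop where
  ne_zero : f ≠ 0
  mem : MemW012 Ω f
  eq : ∀ v : EuclideanSpace ℝ (Fin d) → ℝ, IsTestFunction Ω v →
    ∑ j, ∫ x in Ω, weakGradient Ω f j x * partialDeriv j v x = l * ∫ x in Ω, f x * v x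

/-- `φ` is a complete orthonormal system of `L²(Ω)` that consists of eigenfunctions of the
Dirichlet Laplacian, and `θ` lists the corresponding (positive) eigenvalues. -/
structure IsDirichletEigensystem {d : ℕ} (Ω : Set (EuclideanSpace ℝ (Fin d)))
    (θ : ℕ → ℝ) (φ : HilbertBasis ℕ ℝ (L2 Ω)) : Prop where
  pos : ∀ k, 0 < θ k
  eigen : ∀ k, IsDirichletEigenfunction Ω (θ k) (φ k)

/-- The two-parameter Mittag-Leffler function `E_{a,b}(z) = ∑ z^k / Γ(a k + b)`. -/
def mittagLeffler (a b z : ℝ) : ℝ :=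
  ∑' k : ℕ, z ^ k / Real.Gamma (a * k + b)

section Spectral

variable {d : ℕ} {Ω : Set (EuclideanSpace ℝ (Fin d))} (θ : ℕ → ℝ) (φ : HilbertBasis ℕ ℝ (L2 Ω))

/-- Membership in the Hilbert scale space `D^ν(Ω)`, `ν ≥ 0`. -/
def MemD (ν : ℝ) (w : L2 Ω) : Prop :=
  Summable fun k => θ k ^ ν * (inner ℝ w (φ k)) ^ 2

/-- The norm of `D^ν(Ω)`. -/
def normD (ν : ℝ) (w : L2 Ω) : ℝ :=
  Real.sqrt (∑' k, θ k ^ ν * (inner ℝ w (φ k)) ^ 2)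

/-- `u ∈ C([0,T] → D^1(Ω))`. -/
def ContinuousIntoD1 (T : ℝ) (u : ℝ → L2 Ω) : Prop :=
  (∀ t ∈ Icc 0 T, MemD θ φ 1 (u t)) ∧
    ∀ t ∈ Icc 0 T, Tendsto (fun s => normD θ φ 1 (u s - u t)) (𝓝[Icc 0 T] t) (𝓝 0)

/-- The solution operator `𝒮(t)`. -/
def opS (α t : ℝ) (w : L2 Ω) : L2 Ω :=
  ∑' k, (mittagLeffler α 1 (-θ k * t ^ α / (1 + θ k)) * inner ℝ w (φ k)) • φ k

/-- The solution operator `ℛ(t)`. -/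
def opR (α t : ℝ) (w : L2 Ω) : L2 Ω :=
  ∑' k, (t ^ (α - 1) / (1 + θ k) * mittagLeffler α α (-θ k * t ^ α / (1 + θ k)) *
    inner ℝ w (φ k)) • φ k

/-- The advection source `H(w) = (η · ∇) w`. -/
def advection (η : EuclideanSpace ℝ (Fin d)) (w : L2 Ω) : L2 Ω :=
  ∑ j, η j • weakGradient Ω w j

/-- `u ∈ C([0,T] → D^1(Ω))` is a mild solution on `[0,T]` of
`∂_t^α u - ∂_t^α Δu - Δu = (η · ∇) u` with Dirichlet boundary condition and `u(0) = u₀`. -/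
structure IsMildSolution (α : ℝ) (η : EuclideanSpace ℝ (Fin d)) (u₀ : L2 Ω) (T : ℝ)
    (u : ℝ → L2 Ω) : Prop where
  continuous : ContinuousIntoD1 θ φ T u
  initial : u 0 = u₀
  weakGradient : ∀ t ∈ Icc 0 T, HasWeakGradient Ω (u t)
  integrable : ∀ t ∈ Icc 0 T,
    IntervalIntegrable (fun τ => opR θ φ α (t - τ) (advection η (u τ))) volume 0 t
  eq : ∀ t ∈ Icc 0 T,
    u t = opS θ φ α t u₀ + ∫ τ in (0 : ℝ)..t, opR θ φ α (t - τ) (advection η (u τ))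

/-- The Picard iterates (`picard n` is the `(n+1)`-st one). -/
def picard (α : ℝ) (η : EuclideanSpace ℝ (Fin d)) (u₀ : L2 Ω) : ℕ → ℝ → L2 Ω
  | 0 => fun t => opS θ φ α t u₀
  | n + 1 => fun t => opS θ φ α t u₀ +
      ∫ τ in (0 : ℝ)..t, opR θ φ α (t - τ) (advection η (picard α η u₀ n τ))

/-- The exponentially weighted space `𝕐(a, σ)` of all `w ∈ C([0,T] → D^1(Ω))` with `w(0) = u₀`
and `sup_{0 < t ≤ T} t^a e^{-σ t} ‖w(t)‖_{D^1} < ∞`. -/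
structure MemWeighted (a σ : ℝ) (u₀ : L2 Ω) (T : ℝ) (w : ℝ → L2 Ω) : Prop where
  continuous : ContinuousIntoD1 θ φ T w
  bounded : ∃ M : ℝ, ∀ t ∈ Ioc 0 T, t ^ a * Real.exp (-σ * t) * normD θ φ 1 (w t) ≤ M
  initial : w 0 = u₀

end Spectral

end PseudoParabolic

end

open PseudoParabolic

/-! Let B be the diagonal operator with entries θ_k^(-1/2). It is bounded, since Poincaré keeps θ_k
away from 0, and it maps L² isometrically onto D^1. The gradients of the eigenfunctions are
orthogonal with norms √θ_k, so ∇B is an isometry V into (L²)^d (`exists_gradient_isometry`). Hence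
H∘B is a bounded operator G on L², which gives the Lipschitz bound.

Write u = Bx. Since 1/(1+θ) = θ^(-1/2) · √θ/(1+θ) and √θ/(1+θ) ≤ 1, the kernel factors as ℛ(s)HB = B
s^(α-1) k(s) with k(s) bounded on L². The numbers θ_k/(1+θ_k) lie in [0,1] and E_{α,α} is
continuous, so k is continuous in operator norm. The mild equation becomes a linear Volterra
equation in L² with the integrable singularity s^(α-1). In the norm sup e^(-σt)‖x(t)‖ its operator
has norm at most Mσ^(-α)Γ(α), a contraction for large σ; so there is a solution on all of [0,T], for
data of any size, and the Picard iterates converge uniformly to it (`exists_volterra_solution`).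

The eigensystem comes from the closure of the graph of ∇ on C_c^∞(Ω). Its projection J to L² is
compact (`rellich_approx`) with dense range, so JJ* is compact, symmetric and injective, and its
eigenvectors form a Hilbert basis. An eigenvalue μ of JJ* corresponds to θ = 1/μ - 1, positive by
`poincare`. -/

/-! ### Continuity of the Mittag-Leffler functions. -/

theorem exp_mul_rpow_le_Gamma {A x : ℝ} (hA : 0 < A) (hx : 1 ≤ x) :
    Real.exp (-(A + 1)) * A ^ (x - 1) ≤ Real.Gamma x := by
  have hx0 : 0 < x := by linarith
  rw [Real.Gamma_eq_integral hx0]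
  have hint := Real.GammaIntegral_convergent hx0
  have hsub : Ioc A (A + 1) ⊆ Ioi 0 := fun y hy => hA.trans hy.1
  have hnn : 0 ≤ᵐ[volume.restrict (Ioi 0)] fun y : ℝ => Real.exp (-y) * y ^ (x - 1) := by
    filter_upwards [ae_restrict_mem measurableSet_Ioi] with y hy
    have : (0 : ℝ) < y := hy
    positivity
  calc Real.exp (-(A + 1)) * A ^ (x - 1)
      = ∫ _ in Ioc A (A + 1), Real.exp (-(A + 1)) * A ^ (x - 1) := by simp
    _ ≤ ∫ y in Ioc A (A + 1), Real.exp (-y) * y ^ (x - 1) := by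
        refine setIntegral_mono_on (integrableOn_const measure_Ioc_lt_top.ne) (hint.mono_set hsub)
          measurableSet_Ioc ?_
        intro y hy
        have h1 : A ≤ y := hy.1.le
        have h2 := hy.2
        gcongr
    _ ≤ _ := setIntegral_mono_set hint hnn (Eventually.of_forall hsub)

theorem summable_pow_div_Gamma {a b : ℝ} (ha : 0 < a) (hb : 0 < b) {R : ℝ} (hR : 0 < R) :
    Summable fun n : ℕ => R ^ n / Real.Gamma (a * n + b) := by
  -- With A^a = 2R the lower bound for Γ(an+b) grows like (2R)^n, so the terms are dominated by a
  -- geometric series of ratio 1/2.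
  set A : ℝ := (2 * R) ^ a⁻¹
  have hA : 0 < A := by positivity
  have hAa : A ^ a = 2 * R := by
    rw [← Real.rpow_mul (by positivity), inv_mul_cancel₀ ha.ne', Real.rpow_one]
  set C : ℝ := (Real.exp (-(A + 1)) * A ^ (b - 1))⁻¹
  have hsum : Summable fun n : ℕ => C * (1 / 2 : ℝ) ^ n :=
    (summable_geometric_of_lt_one (by norm_num) (by norm_num)).mul_left C
  refine summable_of_isBigO_nat hsum (Asymptotics.IsBigO.of_bound 1 ?_)
  filter_upwards [eventually_ge_atTop ⌈a⁻¹⌉₊] with n hn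
  have hn' : a⁻¹ ≤ n := Nat.ceil_le.1 hn
  have h1 : 1 ≤ a * n := by
    calc (1 : ℝ) = a * a⁻¹ := (mul_inv_cancel₀ ha.ne').symm
      _ ≤ a * n := by gcongr
  have hG : 0 < Real.Gamma (a * n + b) := Real.Gamma_pos_of_pos (by linarith)
  have hlow := exp_mul_rpow_le_Gamma hA (x := a * n + b) (by linarith)
  have hpow : A ^ (a * n + b - 1) = (2 * R) ^ n * A ^ (b - 1) := by
    rw [add_sub_assoc, Real.rpow_add hA, Real.rpow_mul hA.le, hAa, Real.rpow_natCast]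
  rw [hpow] at hlow
  rw [Real.norm_of_nonneg (by positivity), Real.norm_of_nonneg (by positivity), one_mul]
  rw [div_le_iff₀ hG]
  calc R ^ n = C * (1 / 2) ^ n * (Real.exp (-(A + 1)) * ((2 * R) ^ n * A ^ (b - 1))) := by
        have hne : Real.exp (-(A + 1)) * A ^ (b - 1) ≠ 0 := by positivity
        have : C * (1 / 2) ^ n * (Real.exp (-(A + 1)) * ((2 * R) ^ n * A ^ (b - 1)))
          = (C * (Real.exp (-(A + 1)) * A ^ (b - 1))) * ((1 / 2) ^ n * (2 * R) ^ n) := by ring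
        rw [this, inv_mul_cancel₀ hne, ← mul_pow]
        ring_nf
    _ ≤ _ := by gcongr

theorem continuous_mittagLeffler {a b : ℝ} (ha : 0 < a) (hb : 0 < b) :
    Continuous (mittagLeffler a b) := by
  refine continuous_iff_continuousAt.2 fun z => ?_
  have hon : ContinuousOn (mittagLeffler a b) (Metric.ball 0 (‖z‖ + 1)) := by
    refine continuousOn_tsum (fun n => by fun_prop)
      (summable_pow_div_Gamma ha hb (R := ‖z‖ + 1) (by positivity)) ?_
    intro n x hx
    have hG : 0 < Real.Gamma (a * n + b) := Real.Gamma_pos_of_pos (by positivity)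
    rw [norm_div, norm_pow, Real.norm_of_nonneg hG.le]
    have : ‖x‖ ≤ ‖z‖ + 1 := (mem_ball_zero_iff.1 hx).le
    gcongr
  exact hon.continuousAt (Metric.isOpen_ball.mem_nhds (by simp))

/-! ### Weakly singular Volterra equations in a Banach space. -/

section Volterra

variable {E : Type*} [NormedAddCommGroup E] [NormedSpace ℝ E]

/-- The weakly singular Volterra operator with kernel `s ^ (α - 1) • k s`. -/
noncomputable def volterra (α : ℝ) (k : ℝ → E →L[ℝ] E) (y : ℝ → E) (t : ℝ) : E :=
  ∫ τ in (0 : ℝ)..t, (t - τ) ^ (α - 1) • k (t - τ) (y τ)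

/-- The Picard iterates of `x = f + volterra α k x`. -/
noncomputable def volterraIter (α : ℝ) (k : ℝ → E →L[ℝ] E) (f : ℝ → E) : ℕ → ℝ → E
  | 0 => f
  | n + 1 => fun t => f t + volterra α k (volterraIter α k f n) t

theorem volterra_congr {α : ℝ} {k : ℝ → E →L[ℝ] E} {y z : ℝ → E} {t : ℝ} (ht : 0 ≤ t)
    (h : EqOn y z (Icc 0 t)) : volterra α k y t = volterra α k z t := by
  refine intervalIntegral.integral_congr fun τ hτ => ?_
  rw [uIcc_of_le ht] at hτ
  simp only [h hτ]

theorem intervalIntegrable_sub_rpow {α : ℝ} (hα : 0 < α) (t : ℝ) :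
    IntervalIntegrable (fun τ => (t - τ) ^ (α - 1)) volume 0 t := by
  have := (intervalIntegral.intervalIntegrable_rpow' (a := t) (b := 0)
    (r := α - 1) (by linarith)).comp_sub_left t
  simpa using this

theorem intervalIntegrable_volterra {α : ℝ} (hα : 0 < α) {k : ℝ → E →L[ℝ] E} (hk : Continuous k)
    {y : ℝ → E} {t : ℝ} (ht : 0 ≤ t) (hy : ContinuousOn y (Icc 0 t)) :
    IntervalIntegrable (fun τ => (t - τ) ^ (α - 1) • k (t - τ) (y τ)) volume 0 t := by
  refine (intervalIntegrable_sub_rpow hα t).smul_continuousOn ?_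
  rw [uIcc_of_le ht]
  exact ContinuousOn.clm_apply (by fun_prop) hy

/-- The substitution τ = t - tr fixes both the interval and the singularity, so that t enters only
through continuous factors and dominated convergence gives continuity in t. -/
theorem volterra_eq_scaled {α : ℝ} (hα : 0 < α) (k : ℝ → E →L[ℝ] E) (y : ℝ → E) {t : ℝ}
    (ht : 0 ≤ t) : volterra α k y t =
      t ^ α • ∫ r in (0 : ℝ)..1, r ^ (α - 1) • k (t * r) (y (t - t * r)) := by
  rcases ht.eq_or_lt with rfl | ht
  · simp [volterra, Real.zero_rpow hα.ne']
  have h := intervalIntegral.integral_comp_sub_mul (a := 0) (b := 1)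
    (fun τ => (t - τ) ^ (α - 1) • k (t - τ) (y τ)) ht.ne' t
  simp only [mul_one, sub_self, mul_zero, sub_zero, sub_sub_cancel] at h
  have h2 : volterra α k y t =
      t • ∫ r in (0 : ℝ)..1, (t * r) ^ (α - 1) • k (t * r) (y (t - t * r)) := by
    rw [h, smul_smul, mul_inv_cancel₀ ht.ne', one_smul, volterra]
  rw [h2]
  have h3 : ∫ r in (0 : ℝ)..1, (t * r) ^ (α - 1) • k (t * r) (y (t - t * r)) =
      ∫ r in (0 : ℝ)..1, t ^ (α - 1) • (r ^ (α - 1) • k (t * r) (y (t - t * r))) := by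
    refine intervalIntegral.integral_congr fun r hr => ?_
    rw [uIcc_of_le zero_le_one] at hr
    simp only [Real.mul_rpow ht.le hr.1, mul_smul]
  rw [h3, intervalIntegral.integral_smul, smul_smul]
  congr 1
  rw [← Real.rpow_one_add' ht.le (by linarith)]
  congr 1
  ring

theorem continuousOn_volterra {α : ℝ} (hα : 0 < α) {k : ℝ → E →L[ℝ] E} (hk : Continuous k)
    {y : ℝ → E} (hy : Continuous y) : ContinuousOn (volterra α k y) (Ici 0) := by
  have hc : Continuous fun t : ℝ =>
      t ^ α • ∫ r in (0 : ℝ)..1, r ^ (α - 1) • k (t * r) (y (t - t * r)) := by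
    refine (Real.continuous_rpow_const hα.le).smul ?_
    refine continuous_iff_continuousAt.2 fun t₀ => ?_
    have hF : Continuous fun p : ℝ × ℝ => k (p.1 * p.2) (y (p.1 - p.1 * p.2)) := by fun_prop
    obtain ⟨M, hM⟩ := ((isCompact_closedBall t₀ 1).prod (isCompact_Icc (a := (0 : ℝ))
      (b := 1))).exists_bound_of_continuousOn hF.continuousOn
    have hpow : IntervalIntegrable (fun r : ℝ => r ^ (α - 1)) volume 0 1 :=
      intervalIntegral.intervalIntegrable_rpow' (by linarith)
    refine intervalIntegral.continuousAt_of_dominated_interval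
      (bound := fun r => r ^ (α - 1) * M) ?_ ?_ (hpow.mul_const M) ?_
    · refine Eventually.of_forall fun t => ?_
      have : IntervalIntegrable (fun r => r ^ (α - 1) • k (t * r) (y (t - t * r))) volume 0 1 :=
        hpow.smul_continuousOn (by fun_prop)
      exact this.def'.aestronglyMeasurable
    · filter_upwards [Metric.closedBall_mem_nhds t₀ one_pos] with t ht
      refine Eventually.of_forall fun r hr => ?_
      rw [uIoc_of_le zero_le_one] at hr
      have hr0 : (0 : ℝ) ≤ r ^ (α - 1) := Real.rpow_nonneg hr.1.le _
      rw [norm_smul, Real.norm_of_nonneg hr0]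
      exact mul_le_mul_of_nonneg_left (hM (t, r) ⟨ht, hr.1.le, hr.2⟩) hr0
    · exact Eventually.of_forall fun r _ => by fun_prop
  exact hc.continuousOn.congr fun t ht => volterra_eq_scaled hα k y ht

/-- The weights combine to e^(-σ(t-τ)), which joins the kernel; what remains is part of the integral
∫₀^∞ s^(α-1) e^(-σs) ds = σ^(-α) Γ(α). -/
theorem norm_exp_smul_volterra_le {α σ T M C : ℝ} (hα : 0 < α) (hσ : 0 < σ) {k : ℝ → E →L[ℝ] E}
    (hM : ∀ s ∈ Icc 0 T, ‖k s‖ ≤ M) (hM0 : 0 ≤ M) (hC0 : 0 ≤ C)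
    {h : ℝ → E} (hC : ∀ s, ‖h s‖ ≤ C) {t : ℝ} (ht : t ∈ Icc 0 T) :
    ‖Real.exp (-σ * t) • volterra α k (fun τ => Real.exp (σ * τ) • h τ) t‖ ≤
      (1 / σ) ^ α * Real.Gamma α * M * C := by
  have hΓ := Real.integral_rpow_mul_exp_neg_mul_Ioi hα hσ
  -- A nonzero Bochner integral forces integrability.
  have hΓi : IntegrableOn (fun s : ℝ => s ^ (α - 1) * Real.exp (-(σ * s))) (Ioi 0) :=
    Integrable.of_integral_ne_zero (by rw [hΓ]; have := Real.Gamma_pos_of_pos hα; positivity)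
  have hgi : IntervalIntegrable (fun s : ℝ => s ^ (α - 1) * Real.exp (-(σ * s))) volume 0 t := by
    rw [intervalIntegrable_iff_integrableOn_Ioc_of_le ht.1]
    exact hΓi.mono_set fun s hs => hs.1
  have hgi' : IntervalIntegrable (fun τ : ℝ => (t - τ) ^ (α - 1) * Real.exp (-(σ * (t - τ))))
      volume 0 t := by simpa using (hgi.comp_sub_left t).symm
  rw [volterra, ← intervalIntegral.integral_smul]
  calc _ ≤ ∫ τ in (0 : ℝ)..t, (t - τ) ^ (α - 1) * Real.exp (-(σ * (t - τ))) * (M * C) := by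
        refine intervalIntegral.norm_integral_le_of_norm_le ht.1 ?_ (hgi'.mul_const _)
        refine Eventually.of_forall fun τ hτ => ?_
        have h1 : 0 ≤ t - τ := by linarith [hτ.2]
        rw [norm_smul, norm_smul, map_smul, norm_smul, Real.norm_of_nonneg (Real.exp_nonneg _),
          Real.norm_of_nonneg (Real.exp_nonneg _), Real.norm_of_nonneg (Real.rpow_nonneg h1 _)]
        have h2 : ‖k (t - τ) (h τ)‖ ≤ M * C :=
          (ContinuousLinearMap.le_of_opNorm_le_of_le _ (hM _ ⟨h1, by linarith [hτ.1, ht.2]⟩) (hC τ))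
        have h3 : Real.exp (-(σ * (t - τ))) = Real.exp (-σ * t) * Real.exp (σ * τ) := by
          rw [← Real.exp_add]; ring_nf
        rw [h3]
        have h4 := Real.rpow_nonneg h1 (α - 1)
        calc _ = (t - τ) ^ (α - 1) * (Real.exp (-σ * t) * Real.exp (σ * τ)) *
              ‖k (t - τ) (h τ)‖ := by ring
          _ ≤ _ := by gcongr
    _ = (∫ s in (0 : ℝ)..t, s ^ (α - 1) * Real.exp (-(σ * s))) * (M * C) := by
        rw [intervalIntegral.integral_mul_const, intervalIntegral.integral_comp_sub_left
          (fun s => s ^ (α - 1) * Real.exp (-(σ * s))) t]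
        simp
    _ ≤ (1 / σ) ^ α * Real.Gamma α * (M * C) := by
        refine mul_le_mul_of_nonneg_right ?_ (by positivity)
        rw [← hΓ, intervalIntegral.integral_of_le ht.1]
        refine setIntegral_mono_set hΓi ?_ (Eventually.of_forall fun s hs => hs.1)
        filter_upwards [ae_restrict_mem measurableSet_Ioi] with s hs
        have : (0 : ℝ) < s := hs
        positivity
    _ = _ := by ring

theorem volterra_sub {α : ℝ} (hα : 0 < α) {k : ℝ → E →L[ℝ] E} (hk : Continuous k)
    {y z : ℝ → E} (hy : Continuous y) (hz : Continuous z) {t : ℝ} (ht : 0 ≤ t) :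
    volterra α k y t - volterra α k z t = volterra α k (fun τ => y τ - z τ) t := by
  rw [volterra, volterra, volterra, ← intervalIntegral.integral_sub
    (intervalIntegrable_volterra hα hk ht hy.continuousOn)
    (intervalIntegrable_volterra hα hk ht hz.continuousOn)]
  simp [smul_sub]

theorem continuousOn_volterraIter {α T : ℝ} (hα : 0 < α) (hT : 0 < T) {k : ℝ → E →L[ℝ] E}
    (hk : Continuous k) {f : ℝ → E} (hf : Continuous f) (n : ℕ) :
    ContinuousOn (volterraIter α k f n) (Icc 0 T) := by
  induction n with
  | zero => exact hf.continuousOn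
  | succ n ih =>
    -- The iterate is known to be continuous only on [0,T]. Its constant extension is continuous on
    -- ℝ, and the operator at t reads only values on [0,t].
    have hc := continuousOn_volterra hα hk ((continuous_IccExtend_iff (h := hT.le)).2 ih.domRestrict)
    refine hf.continuousOn.add ((hc.mono fun t ht => ht.1).congr fun t ht => ?_)
    refine volterra_congr ht.1 fun s hs => ?_
    rw [IccExtend_of_mem hT.le _ ⟨hs.1, hs.2.trans ht.2⟩]
    rfl

/-- Banach's fixed point theorem for the damped unknown e^(-σt) x(t) in C([0,T], E). Since T is
finite, undoing the damping costs at most e^(σT), so the convergence is uniform without a weight. -/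
theorem exists_volterra_solution [CompleteSpace E] {α T : ℝ} (hα : 0 < α) (hT : 0 < T)
    {k : ℝ → E →L[ℝ] E} (hk : Continuous k) {f : ℝ → E} (hf : Continuous f) :
    ∃ x : ℝ → E, Continuous x ∧ (∀ t ∈ Icc 0 T, x t = f t + volterra α k x t) ∧
      ∀ ε > 0, ∃ N, ∀ n ≥ N, ∀ t ∈ Icc 0 T, ‖volterraIter α k f n t - x t‖ ≤ ε := by
  obtain ⟨M, hM⟩ := (isCompact_Icc (a := (0 : ℝ)) (b := T)).exists_bound_of_continuousOn
    hk.continuousOn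
  have hM0 : 0 ≤ M := (norm_nonneg _).trans (hM 0 ⟨le_rfl, hT.le⟩)
  obtain ⟨σ, hσ, hsmall⟩ : ∃ σ : ℝ, 0 < σ ∧ (1 / σ) ^ α * Real.Gamma α * M ≤ 1 / 2 := by
    have hlim : Tendsto (fun σ : ℝ => (1 / σ) ^ α * Real.Gamma α * M) atTop (𝓝 0) := by
      have h0 : Tendsto (fun σ : ℝ => (1 / σ) ^ α) atTop (𝓝 0) := by
        have := tendsto_inv_atTop_zero (𝕜 := ℝ) |>.rpow_const (p := α) (Or.inr hα.le)
        simpa [Real.zero_rpow hα.ne'] using this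
      simpa using (h0.mul_const (Real.Gamma α)).mul_const M
    obtain ⟨σ, h1, h2⟩ := ((eventually_gt_atTop 0).and
      (hlim.eventually_le_const (show (0 : ℝ) < 1 / 2 by norm_num))).exists
    exact ⟨σ, h1, h2⟩
  let ext (g : C(Icc 0 T, E)) : ℝ → E := fun τ => Real.exp (σ * τ) • IccExtend hT.le g τ
  have hext : ∀ g : C(Icc 0 T, E), Continuous (ext g) := fun g =>
    (by fun_prop : Continuous fun τ : ℝ => Real.exp (σ * τ)).smul g.continuous.Icc_extend'
  let Φ (g : C(Icc 0 T, E)) : C(Icc 0 T, E) :=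
    ⟨fun t => Real.exp (-σ * t) • (f t + volterra α k (ext g) t), by
      have h1 := continuousOn_volterra hα hk (hext g)
      have h2 : Continuous fun t : Icc 0 T => volterra α k (ext g) t :=
        h1.comp_continuous continuous_subtype_val fun t => t.2.1
      fun_prop⟩
  have hΦ : ∀ g (t : Icc 0 T), Φ g t = Real.exp (-σ * t) • (f t + volterra α k (ext g) t) :=
    fun _ _ => rfl
  have hcontr : ContractingWith (1 / 2) Φ := by
    refine ⟨by norm_num, LipschitzWith.of_dist_le_mul fun g g' => ?_⟩
    rw [ContinuousMap.dist_le (by positivity)]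
    intro t
    rw [dist_eq_norm, hΦ, hΦ, ← smul_sub, add_sub_add_left_eq_sub,
      volterra_sub hα hk (hext g) (hext g') t.2.1]
    have h := norm_exp_smul_volterra_le hα hσ hM hM0 (C := dist g g') dist_nonneg
      (h := fun τ => IccExtend hT.le g τ - IccExtend hT.le g' τ) ?_ t.2
    · simp only [smul_sub] at h
      refine h.trans ?_
      have := mul_le_mul_of_nonneg_right hsmall (dist_nonneg (x := g) (y := g'))
      simpa using this
    · intro s
      rw [← dist_eq_norm]
      exact ContinuousMap.dist_apply_le_dist _
  set y := hcontr.fixedPoint Φ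
  have hy : Φ y = y := hcontr.fixedPoint_isFixedPt
  -- The damped version of f, so that the iterates of Φ from here are the damped Picard iterates.
  let g₀ : C(Icc 0 T, E) := ⟨fun t => Real.exp (-σ * t) • f t, by fun_prop⟩
  have hexp : ∀ t : ℝ, Real.exp (σ * t) * Real.exp (-σ * t) = 1 := fun t => by
    rw [← Real.exp_add]; simp
  have hiter : ∀ n, ∀ t ∈ Icc 0 T, volterraIter α k f n t = ext (Φ^[n] g₀) t := by
    intro n
    induction n with
    | zero =>
      intro t ht
      simp only [ext, IccExtend_of_mem hT.le _ ht, Function.iterate_zero, id]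
      change f t = Real.exp (σ * t) • Real.exp (-σ * t) • f t
      rw [smul_smul, hexp, one_smul]
    | succ n ih =>
      intro t ht
      rw [Function.iterate_succ_apply']
      simp only [ext, IccExtend_of_mem hT.le _ ht, hΦ]
      rw [smul_smul, hexp, one_smul]
      change f t + volterra α k (volterraIter α k f n) t = _
      rw [volterra_congr ht.1 fun s hs => ih s ⟨hs.1, hs.2.trans ht.2⟩]
  refine ⟨ext y, hext y, fun t ht => ?_, fun ε hε => ?_⟩
  · conv_lhs => simp only [ext, IccExtend_of_mem hT.le _ ht]
    rw [← hy, hΦ, smul_smul, hexp, one_smul, hy]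
  · have hlim := hcontr.tendsto_iterate_fixedPoint g₀
    obtain ⟨N, hN⟩ := Metric.tendsto_atTop.1 hlim (Real.exp (-(σ * T)) * ε) (by positivity)
    refine ⟨N, fun n hn t ht => ?_⟩
    have h1 : ‖(Φ^[n] g₀) ⟨t, ht⟩ - y ⟨t, ht⟩‖ ≤ Real.exp (-(σ * T)) * ε := by
      rw [← dist_eq_norm]
      exact (ContinuousMap.dist_apply_le_dist _).trans (hN n hn).le
    rw [hiter n t ht]
    simp only [ext, IccExtend_of_mem hT.le _ ht]
    rw [← smul_sub, norm_smul, Real.norm_of_nonneg (Real.exp_nonneg _)]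
    calc _ ≤ Real.exp (σ * T) * (Real.exp (-(σ * T)) * ε) := by
          gcongr
          exact ht.2
      _ = ε := by rw [← mul_assoc, ← Real.exp_add]; simp

end Volterra

/-! ### Operators diagonal in a Hilbert basis. -/

section Diagonal

open scoped BoundedContinuousFunction

variable {H : Type*} [NormedAddCommGroup H] [InnerProductSpace ℝ H]

theorem HilbertBasis.hasSum_sq_inner (φ : HilbertBasis ℕ ℝ H) (x : H) :
    HasSum (fun k => inner ℝ x (φ k) ^ 2) (‖x‖ ^ 2) := by
  have := φ.hasSum_inner_mul_inner x x
  rw [real_inner_self_eq_norm_sq] at this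
  refine this.congr_fun fun k => ?_
  rw [real_inner_comm, sq]

theorem HilbertBasis.exists_inner_eq (φ : HilbertBasis ℕ ℝ H) {c : ℕ → ℝ}
    (hc : Summable fun k => c k ^ 2) : ∃ x : H, ∀ k, inner ℝ x (φ k) = c k := by
  have hmem : Memℓp c 2 := by
    refine memℓp_gen ?_
    simpa using hc
  refine ⟨φ.repr.symm ⟨c, hmem⟩, fun k => ?_⟩
  rw [real_inner_comm, ← φ.repr_apply_apply, LinearIsometryEquiv.apply_symm_apply]

theorem HilbertBasis.ext_inner (φ : HilbertBasis ℕ ℝ H) {x y : H}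
    (h : ∀ k, inner ℝ x (φ k) = inner ℝ y (φ k)) : x = y := by
  apply φ.repr.injective
  ext k
  rw [φ.repr_apply_apply, φ.repr_apply_apply, real_inner_comm, h, real_inner_comm]

theorem HilbertBasis.summable_sq_mul_inner (φ : HilbertBasis ℕ ℝ H) (m : ℕ →ᵇ ℝ) (x : H) :
    Summable fun k => (m k * inner ℝ x (φ k)) ^ 2 := by
  refine Summable.of_nonneg_of_le (fun k => sq_nonneg _) (fun k => ?_)
    ((φ.hasSum_sq_inner x).summable.mul_left (‖m‖ ^ 2))
  rw [mul_pow, ← sq_abs (m k)]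
  gcongr
  exact m.norm_coe_le_norm k

/-- The value at `x` of the operator that is diagonal in `φ`, with the bounded symbol `m`. -/
noncomputable def HilbertBasis.diagonalAux (φ : HilbertBasis ℕ ℝ H) (m : ℕ →ᵇ ℝ) (x : H) : H :=
  (φ.exists_inner_eq (φ.summable_sq_mul_inner m x)).choose

theorem HilbertBasis.inner_diagonalAux (φ : HilbertBasis ℕ ℝ H) (m : ℕ →ᵇ ℝ) (x : H) (k : ℕ) :
    inner ℝ (φ.diagonalAux m x) (φ k) = m k * inner ℝ x (φ k) :=
  (φ.exists_inner_eq (φ.summable_sq_mul_inner m x)).choose_spec k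

/-- The operator that is diagonal in the Hilbert basis `φ`, with the bounded symbol `m`. -/
noncomputable def HilbertBasis.diagonal (φ : HilbertBasis ℕ ℝ H) : (ℕ →ᵇ ℝ) →L[ℝ] H →L[ℝ] H :=
  LinearMap.mkContinuous₂
    (LinearMap.mk₂ ℝ φ.diagonalAux
      (fun m m' x => φ.ext_inner fun k => by
        simp [inner_add_left, φ.inner_diagonalAux, add_mul])
      (fun c m x => φ.ext_inner fun k => by
        simp [real_inner_smul_left, φ.inner_diagonalAux, mul_assoc])
      (fun m x x' => φ.ext_inner fun k => by
        simp [inner_add_left, φ.inner_diagonalAux, mul_add])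
      (fun c m x => φ.ext_inner fun k => by
        simp only [real_inner_smul_left, φ.inner_diagonalAux]
        ring))
    1 (by
      intro m x
      rw [LinearMap.mk₂_apply, one_mul, ← abs_of_nonneg (norm_nonneg (φ.diagonalAux m x)),
        ← abs_of_nonneg (a := ‖m‖ * ‖x‖) (by positivity), ← sq_le_sq, mul_pow]
      refine hasSum_le (fun k => ?_) (φ.hasSum_sq_inner _) ((φ.hasSum_sq_inner x).mul_left (‖m‖ ^ 2))
      rw [φ.inner_diagonalAux, mul_pow, ← sq_abs (m k)]
      gcongr
      exact m.norm_coe_le_norm k)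

theorem HilbertBasis.inner_diagonal (φ : HilbertBasis ℕ ℝ H) (m : ℕ →ᵇ ℝ) (x : H) (k : ℕ) :
    inner ℝ (φ.diagonal m x) (φ k) = m k * inner ℝ x (φ k) :=
  φ.inner_diagonalAux m x k

theorem HilbertBasis.diagonal_diagonal (φ : HilbertBasis ℕ ℝ H) (m m' : ℕ →ᵇ ℝ) (x : H) :
    φ.diagonal m (φ.diagonal m' x) = φ.diagonal (m * m') x :=
  φ.ext_inner fun k => by simp only [φ.inner_diagonal, BoundedContinuousFunction.mul_apply, mul_assoc]

theorem HilbertBasis.tsum_smul_eq_diagonal (φ : HilbertBasis ℕ ℝ H) (m : ℕ →ᵇ ℝ) (x : H) :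
    ∑' k, (m k * inner ℝ x (φ k)) • φ k = φ.diagonal m x := by
  rw [← (φ.hasSum_repr (φ.diagonal m x)).tsum_eq]
  refine tsum_congr fun k => ?_
  rw [φ.repr_apply_apply, ← φ.inner_diagonal, real_inner_comm]

/-- The bounded sequence `k ↦ f (l k)`, for a continuous function `f` on the unit interval. -/
noncomputable def symbol (l : ℕ → unitInterval) (f : C(unitInterval, ℝ)) : ℕ →ᵇ ℝ :=
  (BoundedContinuousFunction.mkOfCompact f).compContinuous ⟨l, continuous_of_discreteTopology⟩

theorem symbol_apply (l : ℕ → unitInterval) (f : C(unitInterval, ℝ)) (k : ℕ) :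
    symbol l f k = f (l k) := rfl

/-- Sampling a function does not increase its sup norm. Through `HilbertBasis.diagonal`, a
continuous curve in C([0,1]) thus yields an operator-norm continuous family. -/
theorem continuous_symbol (l : ℕ → unitInterval) : Continuous (symbol l) :=
  (BoundedContinuousFunction.continuous_compContinuous _).comp
    (ContinuousMap.isometryEquivBoundedOfCompact unitInterval ℝ).continuous

end Diagonal

/-! ### Spectral theory of a compact map with dense range. -/

section Compact

variable {H F : Type*} [NormedAddCommGroup H] [InnerProductSpace ℝ H]
  [NormedAddCommGroup F] [InnerProductSpace ℝ F]

/-- Composing J with the orthogonal projections onto the spaces V gives finite-rank operators that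
converge to J in norm. The projection is the best approximation, so any nearby v in V bounds the
error, and the bound passes from the dense set by continuity. -/
theorem isCompactOperator_of_approx [CompleteSpace F] (J : H →L[ℝ] F) {s : Set H} (hs : Dense s)
    (h : ∀ ε > 0, ∃ V : Submodule ℝ F, FiniteDimensional ℝ V ∧
      ∀ x ∈ s, ∃ v ∈ V, ‖J x - v‖ ≤ ε * ‖x‖) : IsCompactOperator J := by
  choose! V hV hJ using h
  have hpos : ∀ n : ℕ, (0 : ℝ) < 1 / (n + 1) := fun n => Nat.one_div_pos_of_nat
  have hfin : ∀ n : ℕ, FiniteDimensional ℝ (V (1 / (n + 1))) := fun n => hV _ (hpos n)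
  let P (n : ℕ) : H →L[ℝ] F := (V (1 / (n + 1))).starProjection ∘L J
  have hP : ∀ n, IsCompactOperator (P n) := by
    intro n
    have : ProperSpace (V (1 / ((n : ℝ) + 1))) := FiniteDimensional.proper_real _
    have h1 : IsCompactOperator (V (1 / ((n : ℝ) + 1))).subtypeL :=
      isCompactOperator_of_locallyCompactSpace_rng _
    exact h1.comp_clm ((V (1 / ((n : ℝ) + 1))).orthogonalProjectionOnto ∘L J)
  have hb : ∀ n, ‖P n - J‖ ≤ 1 / (n + 1) := by
    intro n
    refine ContinuousLinearMap.opNorm_le_bound _ (hpos n).le fun x => ?_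
    have hcl : IsClosed {x | ‖(P n - J) x‖ ≤ 1 / ((n : ℝ) + 1) * ‖x‖} :=
      isClosed_le (by fun_prop) (by fun_prop)
    refine closure_minimal (fun y hy => ?_) hcl (hs x)
    obtain ⟨v, hv, hle⟩ := hJ _ (hpos n) y hy
    refine le_trans ?_ hle
    rw [sub_apply, norm_sub_rev]
    change ‖J y - (V (1 / ((n : ℝ) + 1))).starProjection (J y)‖ ≤ _
    rw [Submodule.starProjection_minimal]
    exact ciInf_le ⟨0, by rintro _ ⟨w, rfl⟩; exact norm_nonneg _⟩
      (⟨v, hv⟩ : V (1 / ((n : ℝ) + 1)))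
  refine isCompactOperator_of_tendsto (F := P) (l := atTop) ?_ (Eventually.of_forall hP)
  rw [tendsto_iff_norm_sub_tendsto_zero]
  exact squeeze_zero (fun _ => norm_nonneg _) hb tendsto_one_div_add_atTop_nhds_zero_nat

/-- Orthonormal vectors are √2 apart, so balls of radius 1/2 around them are disjoint. -/
theorem Orthonormal.countable [TopologicalSpace.SeparableSpace F] {ι : Type*} {v : ι → F}
    (hv : Orthonormal ℝ v) : Countable ι := by
  refine Pairwise.countable_of_isOpen_disjoint (s := fun i => Metric.ball (v i) (1 / 2)) ?_
    (fun _ => Metric.isOpen_ball) (fun i => ⟨v i, Metric.mem_ball_self (by norm_num)⟩)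
  intro i j hij
  refine Metric.ball_disjoint_ball ?_
  have h : ‖v i - v j‖ ^ 2 = 2 := by
    rw [norm_sub_sq_real, hv.1, hv.1, hv.2 hij]
    norm_num
  rw [dist_eq_norm]
  nlinarith [norm_nonneg (v i - v j)]

/-- Hilbert bases of the eigenspaces together form an orthonormal family, total by the spectral
theorem. Separability makes it countable and infinite dimension makes it infinite, hence indexed by
ℕ. -/
theorem exists_hilbertBasis_of_compact_symmetric [CompleteSpace F]
    [TopologicalSpace.SeparableSpace F] (hinf : ¬ FiniteDimensional ℝ F) {K : F →L[ℝ] F}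
    (hK : IsCompactOperator K) (hsymm : (K : F →ₗ[ℝ] F).IsSymmetric) :
    ∃ (μ : ℕ → ℝ) (φ : HilbertBasis ℕ ℝ F), ∀ k, K (φ k) = μ k • φ k := by
  let V (μ : ℝ) : Submodule ℝ F := Module.End.eigenspace (K : F →ₗ[ℝ] F) μ
  have hcl : ∀ μ, IsClosed (V μ : Set F) := by
    intro μ
    have : (V μ : Set F) = {x | K x = μ • x} := by
      ext x
      exact Module.End.mem_eigenspace_iff
    rw [this]
    exact isClosed_eq (by fun_prop) (by fun_prop)
  have hcomp : ∀ μ, CompleteSpace (V μ) := fun μ => (hcl μ).completeSpace_coe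
  choose w b hb using fun μ => exists_hilbertBasis ℝ (V μ)
  let v (i : Σ μ, w μ) : F := (b i.1 i.2 : F)
  have hv : Orthonormal ℝ v :=
    hsymm.orthogonalFamily_eigenspaces.orthonormal_sigma_orthonormal
      (v_family := fun μ i => b μ i) fun μ => (b μ).orthonormal
  have hbot : (Submodule.span ℝ (range v))ᗮ = ⊥ := by
    rw [eq_bot_iff, ← ContinuousLinearMap.orthogonalComplement_iSup_eigenspaces_eq_bot hK hsymm]
    intro x hx
    rw [← Submodule.iInf_orthogonal, Submodule.mem_iInf]
    intro μ y hy
    have hz : (V μ).orthogonalProjectionOnto x = 0 := by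
      apply (b μ).repr.injective
      ext i
      rw [(b μ).repr_apply_apply, map_zero, Submodule.inner_orthogonalProjectionOnto_eq_of_mem_left]
      exact hx _ (Submodule.subset_span ⟨⟨μ, i⟩, rfl⟩)
    have := Submodule.inner_orthogonalProjectionOnto_eq_of_mem_left (K := V μ) ⟨y, hy⟩ x
    rw [hz, inner_zero_right] at this
    exact this.symm
  have hcount : Countable (Σ μ, w μ) := hv.countable
  have hinfi : Infinite (Σ μ, w μ) := by
    by_contra hfin
    rw [not_infinite_iff_finite] at hfin
    have := Fintype.ofFinite (Σ μ, w μ)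
    exact hinf (Module.Basis.finiteDimensional_of_finite
      (HilbertBasis.mkOfOrthogonalEqBot hv hbot).toOrthonormalBasis.toBasis)
  obtain ⟨e⟩ : Nonempty (ℕ ≃ Σ μ, w μ) := nonempty_equiv_of_countable
  have hrange : range (v ∘ e) = range v := e.surjective.range_comp v
  refine ⟨fun k => (e k).1, HilbertBasis.mkOfOrthogonalEqBot (hv.comp e e.injective)
    (by rw [hrange, hbot]), fun k => ?_⟩
  rw [HilbertBasis.coe_mkOfOrthogonalEqBot]
  exact Module.End.mem_eigenspace_iff.1 (b (e k).1 (e k).2).2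

/-- Diagonalise JJ*. If JJ*φ = 0 then ‖J*φ‖² = ⟨φ, JJ*φ⟩ = 0, so φ is orthogonal to the range of J
and vanishes. Every eigenvalue μ is therefore nonzero, and μ⁻¹J*φ is the lift of φ, with l = 1/μ. -/
theorem exists_hilbertBasis_of_compact_embedding [CompleteSpace H] [CompleteSpace F]
    [TopologicalSpace.SeparableSpace F] (hinf : ¬ FiniteDimensional ℝ F) {J : H →L[ℝ] F}
    (hJ : IsCompactOperator J) (hdense : ∀ f : F, (∀ x, inner ℝ f (J x) = 0) → f = 0) :
    ∃ (l : ℕ → ℝ) (φ : HilbertBasis ℕ ℝ F) (p : ℕ → H), ∀ k, J (p k) = φ k ∧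
      ∀ x, inner ℝ (p k) x = l k * inner ℝ (φ k) (J x) := by
  set A : F →L[ℝ] H := ContinuousLinearMap.adjoint J
  have hA : ∀ f x, inner ℝ (A f) x = inner ℝ f (J x) := fun f x =>
    ContinuousLinearMap.adjoint_inner_left J x f
  have hsymm : ((J ∘L A : F →L[ℝ] F) : F →ₗ[ℝ] F).IsSymmetric := by
    intro x y
    change inner ℝ (J (A x)) y = inner ℝ x (J (A y))
    rw [← hA, real_inner_comm, ← hA, real_inner_comm]
  obtain ⟨μ, φ, hφ⟩ := exists_hilbertBasis_of_compact_symmetric hinf (hJ.comp_clm A) hsymm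
  refine ⟨fun k => (μ k)⁻¹, φ, fun k => (μ k)⁻¹ • A (φ k), fun k => ⟨?_, fun x => ?_⟩⟩
  · have hJA : J (A (φ k)) = μ k • φ k := hφ k
    have hμ : μ k ≠ 0 := by
      intro h0
      have hnorm : ‖φ k‖ = 1 := φ.orthonormal.1 k
      have hA0 : A (φ k) = 0 := by
        rw [← inner_self_eq_zero (𝕜 := ℝ), hA, hJA, h0, zero_smul, inner_zero_right]
      have hφ0 : φ k = 0 := hdense _ fun x => by rw [← hA, hA0, inner_zero_left]
      simp [hφ0] at hnorm
    rw [map_smul, hJA, smul_smul, inv_mul_cancel₀ hμ, one_smul]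
  · rw [real_inner_smul_left, hA]

theorem exists_hilbertBasis_of_approx [CompleteSpace H] [CompleteSpace F]
    [TopologicalSpace.SeparableSpace F] (hinf : ¬ FiniteDimensional ℝ F) (G : Submodule ℝ H)
    (T : H →L[ℝ] F) (hT : ∀ ε > 0, ∃ V : Submodule ℝ F, FiniteDimensional ℝ V ∧
      ∀ x ∈ G, ∃ v ∈ V, ‖T x - v‖ ≤ ε * ‖x‖)
    (hdense : ∀ f : F, (∀ x ∈ G, inner ℝ f (T x) = 0) → f = 0) :
    ∃ (l : ℕ → ℝ) (φ : HilbertBasis ℕ ℝ F) (p : ℕ → H), ∀ k, p k ∈ G.topologicalClosure ∧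
      T (p k) = φ k ∧ ∀ x ∈ G.topologicalClosure, inner ℝ (p k) x = l k * inner ℝ (φ k) (T x) := by
  have : CompleteSpace G.topologicalClosure := G.isClosed_topologicalClosure.completeSpace_coe
  have hJ : IsCompactOperator (T ∘L G.topologicalClosure.subtypeL) := by
    refine isCompactOperator_of_approx _ (s := {x | (x : H) ∈ G}) ?_ fun ε hε => ?_
    · refine Subtype.dense_iff.2 fun p hp => closure_mono (s := (G : Set H)) (fun q hq => ?_) hp
      exact ⟨⟨q, subset_closure hq⟩, hq, rfl⟩
    · obtain ⟨V, hV, h⟩ := hT ε hε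
      exact ⟨V, hV, fun x hx => h x hx⟩
  obtain ⟨l, φ, p, hp⟩ := exists_hilbertBasis_of_compact_embedding hinf hJ
    fun f hf => hdense f fun x hx => hf ⟨x, subset_closure hx⟩
  exact ⟨l, φ, fun k => p k, fun k => ⟨(p k).2, (hp k).1, fun x hx => (hp k).2 ⟨x, hx⟩⟩⟩

end Compact

/-! ### Translation and averaging estimates for C¹ functions. -/

theorem ofReal_sq_setAverage_le {X : Type*} [MeasurableSpace X] {μ : Measure X} {t : Set X}
    (h0 : μ t ≠ 0) (ht : μ t ≠ ⊤) {f : X → ℝ} (hf : IntegrableOn f t μ)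
    (hf2 : IntegrableOn (fun x => f x ^ 2) t μ) :
    ENNReal.ofReal ((⨍ x in t, f x ∂μ) ^ 2) ≤ (μ t)⁻¹ * ∫⁻ x in t, ENNReal.ofReal (f x ^ 2) ∂μ := by
  have hJ := ConvexOn.map_set_average_le (s := univ) (g := fun y : ℝ => y ^ 2)
    (Even.convexOn_pow even_two) (by fun_prop) isClosed_univ h0 ht (by simp) hf hf2
  refine (ENNReal.ofReal_le_ofReal hJ).trans ?_
  rw [setAverage_eq, smul_eq_mul, ENNReal.ofReal_mul (by positivity), Measure.real,
    ofReal_integral_eq_lintegral_ofReal hf2 (Eventually.of_forall fun x => sq_nonneg _),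
    ENNReal.ofReal_inv_of_pos (ENNReal.toReal_pos h0 ht), ENNReal.ofReal_toReal ht]

section Estimates

variable {d : ℕ}

theorem sq_fderiv_apply_le (v : EuclideanSpace ℝ (Fin d) → ℝ) (x z : EuclideanSpace ℝ (Fin d)) :
    fderiv ℝ v x z ^ 2 ≤ ‖z‖ ^ 2 * ∑ j, partialDeriv j v x ^ 2 := by
  have hz : fderiv ℝ v x z = ∑ j, z j * partialDeriv j v x := by
    have h := (EuclideanSpace.basisFun (Fin d) ℝ).sum_repr z
    conv_lhs => rw [← h]
    simp [partialDeriv]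
  rw [hz, EuclideanSpace.real_norm_sq_eq]
  exact Finset.sum_mul_sq_le_sq_mul_sq _ _ _

/-- Write the difference as the integral of the derivative along the segment, apply Jensen, and use
Tonelli and translation invariance. -/
theorem lintegral_translate_sub_sq_le {v : EuclideanSpace ℝ (Fin d) → ℝ} (hv : ContDiff ℝ 1 v)
    (z : EuclideanSpace ℝ (Fin d)) :
    ∫⁻ x, ENNReal.ofReal ((v (x + z) - v x) ^ 2) ≤
      ENNReal.ofReal (‖z‖ ^ 2) * ∫⁻ x, ENNReal.ofReal (∑ j, partialDeriv j v x ^ 2) := by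
  have hfd := hv.continuous_fderiv one_ne_zero
  have hcont : Continuous fun p : EuclideanSpace ℝ (Fin d) × ℝ => fderiv ℝ v (p.1 + p.2 • z) z := by
    fun_prop
  have hpt : ∀ x, ENNReal.ofReal ((v (x + z) - v x) ^ 2) ≤
      ∫⁻ s in Ioc (0 : ℝ) 1, ENNReal.ofReal (fderiv ℝ v (x + s • z) z ^ 2) := by
    intro x
    have hc : Continuous fun s : ℝ => fderiv ℝ v (x + s • z) z :=
      hcont.comp (Continuous.prodMk_right x)
    have hFTC : ∫ s in (0 : ℝ)..1, fderiv ℝ v (x + s • z) z = v (x + z) - v x := by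
      have hd : ∀ s : ℝ, HasDerivAt (fun s : ℝ => v (x + s • z)) (fderiv ℝ v (x + s • z) z) s := by
        intro s
        have h1 : HasDerivAt (fun s : ℝ => x + s • z) z s := by
          simpa using ((hasDerivAt_id s).smul_const z).const_add x
        exact ((hv.differentiable one_ne_zero) _).hasFDerivAt.comp_hasDerivAt s h1
      rw [intervalIntegral.integral_eq_sub_of_hasDerivAt (fun s _ => hd s)
        (hc.intervalIntegrable _ _)]
      simp
    have h := ofReal_sq_setAverage_le (μ := volume) (t := Ioc (0 : ℝ) 1) (by simp) (by simp)
      (hc.integrableOn_Ioc) ((hc.pow 2).integrableOn_Ioc)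
    rw [setAverage_eq, ← intervalIntegral.integral_of_le zero_le_one, hFTC] at h
    simpa using h
  calc ∫⁻ x, ENNReal.ofReal ((v (x + z) - v x) ^ 2)
      ≤ ∫⁻ x, ∫⁻ s in Ioc (0 : ℝ) 1, ENNReal.ofReal (fderiv ℝ v (x + s • z) z ^ 2) :=
        lintegral_mono hpt
    _ = ∫⁻ s in Ioc (0 : ℝ) 1, ∫⁻ x, ENNReal.ofReal (fderiv ℝ v (x + s • z) z ^ 2) :=
        lintegral_lintegral_swap (by fun_prop)
    _ = ∫⁻ _ in Ioc (0 : ℝ) 1, ∫⁻ x, ENNReal.ofReal (fderiv ℝ v x z ^ 2) := by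
        refine lintegral_congr fun s => ?_
        exact lintegral_add_right_eq_self (fun x => ENNReal.ofReal (fderiv ℝ v x z ^ 2)) (s • z)
    _ = ∫⁻ x, ENNReal.ofReal (fderiv ℝ v x z ^ 2) := by simp
    _ ≤ ∫⁻ x, ENNReal.ofReal (‖z‖ ^ 2) * ENNReal.ofReal (∑ j, partialDeriv j v x ^ 2) := by
        refine lintegral_mono fun x => ?_
        rw [← ENNReal.ofReal_mul (by positivity)]
        exact ENNReal.ofReal_le_ofReal (sq_fderiv_apply_le v x z)
    _ = _ := lintegral_const_mul' _ _ ENNReal.ofReal_ne_top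

/-- Jensen, and then the ball about y is enlarged to the ball of radius 2r about x. The resulting
bound no longer depends on y. -/
theorem ofReal_sq_sub_average_le {v : EuclideanSpace ℝ (Fin d) → ℝ} (hv : Continuous v) {r : ℝ}
    (hr : 0 < r) {x y : EuclideanSpace ℝ (Fin d)} (hxy : dist y x ≤ r) :
    ENNReal.ofReal ((v x - ⨍ w in Metric.ball y r, v w) ^ 2) ≤
      (volume (Metric.ball (0 : EuclideanSpace ℝ (Fin d)) r))⁻¹ *
        ∫⁻ z in Metric.ball 0 (2 * r), ENNReal.ofReal ((v (x + z) - v x) ^ 2) := by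
  have h0 : volume (Metric.ball y r) ≠ 0 := (Metric.measure_ball_pos _ _ hr).ne'
  have htop : volume (Metric.ball y r) ≠ ⊤ := measure_ball_lt_top.ne
  have hint : ∀ f : EuclideanSpace ℝ (Fin d) → ℝ, Continuous f →
      IntegrableOn f (Metric.ball y r) := fun f hf =>
    (hf.continuousOn.integrableOn_compact (isCompact_closedBall y r)).mono_set
      Metric.ball_subset_closedBall
  have h := ofReal_sq_setAverage_le h0 htop (hint (fun w => v w - v x) (by fun_prop))
    (hint _ (by fun_prop))
  have havg : ⨍ w in Metric.ball y r, (v w - v x) = (⨍ w in Metric.ball y r, v w) - v x := by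
    rw [setAverage_eq, setAverage_eq, integral_sub (hint v hv) (hint _ continuous_const),
      smul_sub, ← setAverage_eq, ← setAverage_eq, setAverage_const h0 htop]
  rw [havg, ← neg_sq, neg_sub, Measure.addHaar_ball_center] at h
  refine h.trans (mul_le_mul_right ?_ _)
  have hsub : Metric.ball y r ⊆ Metric.ball x (2 * r) :=
    Metric.ball_subset_ball' (by linarith)
  refine (lintegral_mono_set hsub).trans_eq ?_
  have hpre : (fun z => x + z) ⁻¹' Metric.ball x (2 * r) = Metric.ball 0 (2 * r) := by
    ext z; simp
  rw [← hpre]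
  exact ((measurePreserving_add_left volume x).setLIntegral_comp_preimage_emb
    (measurableEmbedding_addLeft x) (fun w => ENNReal.ofReal ((v w - v x) ^ 2)) _).symm

/-- By Tonelli the pointwise bound becomes a mean of translation estimates over ‖z‖ < 2r. The factor
2^d is the volume ratio of the balls of radius 2r and r. -/
theorem setLIntegral_sub_average_sq_le {v : EuclideanSpace ℝ (Fin d) → ℝ} (hv : ContDiff ℝ 1 v)
    {r : ℝ} (hr : 0 < r) {s : Set (EuclideanSpace ℝ (Fin d))} (hs : MeasurableSet s)
    {q : EuclideanSpace ℝ (Fin d) → EuclideanSpace ℝ (Fin d)} (hq : ∀ x ∈ s, dist (q x) x ≤ r) :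
    ∫⁻ x in s, ENNReal.ofReal ((v x - ⨍ w in Metric.ball (q x) r, v w) ^ 2) ≤
      ENNReal.ofReal (2 ^ d * (2 * r) ^ 2) * ∫⁻ x, ENNReal.ofReal (∑ j, partialDeriv j v x ^ 2) := by
  set D := ∫⁻ x, ENNReal.ofReal (∑ j, partialDeriv j v x ^ 2)
  set B := volume (Metric.ball (0 : EuclideanSpace ℝ (Fin d)) r)
  have hB0 : B ≠ 0 := (Metric.measure_ball_pos _ _ hr).ne'
  have hBt : B ≠ ⊤ := measure_ball_lt_top.ne
  have hB2 : volume (Metric.ball (0 : EuclideanSpace ℝ (Fin d)) (2 * r)) =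
      ENNReal.ofReal (2 ^ d) * B := by
    rw [Measure.addHaar_ball_mul_of_pos _ _ two_pos]
    simp [B]
  have hvc := hv.continuous
  calc _ ≤ ∫⁻ x in s, B⁻¹ * ∫⁻ z in Metric.ball 0 (2 * r), ENNReal.ofReal ((v (x + z) - v x) ^ 2) :=
        setLIntegral_mono' hs fun x hx => ofReal_sq_sub_average_le hvc hr (hq x hx)
    _ ≤ ∫⁻ x, B⁻¹ * ∫⁻ z in Metric.ball 0 (2 * r), ENNReal.ofReal ((v (x + z) - v x) ^ 2) :=
        setLIntegral_le_lintegral _ _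
    _ = B⁻¹ * ∫⁻ x, ∫⁻ z in Metric.ball 0 (2 * r), ENNReal.ofReal ((v (x + z) - v x) ^ 2) :=
        lintegral_const_mul' _ _ (ENNReal.inv_ne_top.2 hB0)
    _ = B⁻¹ * ∫⁻ z in Metric.ball 0 (2 * r), ∫⁻ x, ENNReal.ofReal ((v (x + z) - v x) ^ 2) := by
        rw [lintegral_lintegral_swap]
        exact (by fun_prop : Continuous fun p : EuclideanSpace ℝ (Fin d) × EuclideanSpace ℝ (Fin d)
          => (v (p.1 + p.2) - v p.1) ^ 2).measurable.ennreal_ofReal.aemeasurable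
    _ ≤ B⁻¹ * ∫⁻ _ in Metric.ball (0 : EuclideanSpace ℝ (Fin d)) (2 * r),
          ENNReal.ofReal ((2 * r) ^ 2) * D := by
        refine mul_le_mul_right (setLIntegral_mono' measurableSet_ball fun z hz => ?_) _
        refine (lintegral_translate_sub_sq_le hv z).trans ?_
        have : ‖z‖ ≤ 2 * r := (mem_ball_zero_iff.1 hz).le
        gcongr
    _ = (B⁻¹ * B) * (ENNReal.ofReal (2 ^ d * (2 * r) ^ 2) * D) := by
        rw [setLIntegral_const, hB2, ENNReal.ofReal_mul (by positivity)]
        ring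
    _ = _ := by rw [ENNReal.inv_mul_cancel hB0 hBt, one_mul]

/-- A shift by 2|R| moves the support off itself: wherever v(x) ≠ 0 one has v(x+z) = 0, so the
translation estimate bounds v itself. -/
theorem lintegral_sq_le_of_support_subset_ball (hd : 0 < d) {R : ℝ}
    {v : EuclideanSpace ℝ (Fin d) → ℝ}
    (hv : ContDiff ℝ 1 v) (hsupp : Function.support v ⊆ Metric.ball 0 R) :
    ∫⁻ x, ENNReal.ofReal (v x ^ 2) ≤
      ENNReal.ofReal ((2 * |R|) ^ 2) * ∫⁻ x, ENNReal.ofReal (∑ j, partialDeriv j v x ^ 2) := by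
  set z : EuclideanSpace ℝ (Fin d) := EuclideanSpace.single ⟨0, hd⟩ (2 * |R|)
  have hz : ‖z‖ = 2 * |R| := by simp [z]
  have hle := lintegral_translate_sub_sq_le hv z
  rw [hz] at hle
  refine le_trans (lintegral_mono fun x => ?_) hle
  by_cases hx : v x = 0
  · simp [hx]
  have hxR : ‖x‖ < |R| := (mem_ball_zero_iff.1 (hsupp hx)).trans_le (le_abs_self R)
  have hxz : v (x + z) = 0 := by
    by_contra hne
    have h1 : ‖x + z‖ < |R| := (mem_ball_zero_iff.1 (hsupp hne)).trans_le (le_abs_self R)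
    have h2 : ‖z‖ ≤ ‖x + z‖ + ‖x‖ := by simpa using norm_sub_le (x + z) x
    linarith
  simp [hxz]

end Estimates

namespace PseudoParabolic

/-! ### The space W_0^{1,2} as a closed graph. -/

section Sobolev

variable {d : ℕ} {Ω : Set (EuclideanSpace ℝ (Fin d))}

theorem inner_L2_eq_integral (f g : L2 Ω) : inner ℝ f g = ∫ x in Ω, f x * g x := by
  rw [L2.inner_def]
  simp [mul_comm]

namespace IsTestFunction

variable {v w : EuclideanSpace ℝ (Fin d) → ℝ}

theorem zero : IsTestFunction Ω (0 : EuclideanSpace ℝ (Fin d) → ℝ) :=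
  ⟨contDiff_const, HasCompactSupport.zero, by simp [tsupport]⟩

theorem add (hv : IsTestFunction Ω v) (hw : IsTestFunction Ω w) : IsTestFunction Ω (v + w) :=
  ⟨hv.smooth.add hw.smooth, hv.compact.add hw.compact,
    (tsupport_add v w).trans (union_subset hv.support hw.support)⟩

theorem smul (c : ℝ) (hv : IsTestFunction Ω v) : IsTestFunction Ω (c • v) :=
  ⟨hv.smooth.const_smul c, hv.compact.smul_left (f := fun _ => c),
    (tsupport_smul_subset_right (fun _ => c) v).trans hv.support⟩

theorem partialDeriv (hv : IsTestFunction Ω v) (j : Fin d) :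
    IsTestFunction Ω (partialDeriv j v) :=
  ⟨(hv.smooth.fderiv_right (m := ∞) (by simp)).clm_apply contDiff_const,
    hv.compact.fderiv_apply ℝ _, (tsupport_fderiv_apply_subset ℝ _).trans hv.support⟩

theorem memLp (hv : IsTestFunction Ω v) : MemLp v 2 (volume.restrict Ω) :=
  (hv.smooth.continuous.memLp_of_hasCompactSupport hv.compact).restrict Ω

theorem eq_zero_of_notMem (hv : IsTestFunction Ω v) {x : EuclideanSpace ℝ (Fin d)} (hx : x ∉ Ω) :
    v x = 0 :=
  image_eq_zero_of_notMem_tsupport fun h => hx (hv.support h)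

/-- The class of a test function in `L²(Ω)`. -/
noncomputable def toL2 (hv : IsTestFunction Ω v) : L2 Ω := hv.memLp.toLp v

theorem coeFn_toL2 (hv : IsTestFunction Ω v) : hv.toL2 =ᵐ[volume.restrict Ω] v :=
  hv.memLp.coeFn_toLp

theorem toL2_congr (hv : IsTestFunction Ω v) (hw : IsTestFunction Ω w) (h : v = w) :
    hv.toL2 = hw.toL2 := by
  subst h; rfl

theorem integral_mul (hv : IsTestFunction Ω v) (f : L2 Ω) :
    ∫ x in Ω, f x * v x = inner ℝ f hv.toL2 := by
  rw [inner_L2_eq_integral]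
  refine integral_congr_ae ?_
  filter_upwards [hv.coeFn_toL2] with x hx
  rw [hx]

/-- The pair `(v, ∇v)` of a test function, in `L²(Ω) × L²(Ω)^d`. -/
noncomputable def toPair (hv : IsTestFunction Ω v) :
    WithLp 2 (L2 Ω × PiLp 2 fun _ : Fin d => L2 Ω) :=
  WithLp.toLp 2 (hv.toL2, WithLp.toLp 2 fun j => (hv.partialDeriv j).toL2)

theorem partialDeriv_add (hv : IsTestFunction Ω v) (hw : IsTestFunction Ω w) (j : Fin d) :
    PseudoParabolic.partialDeriv j (v + w) =
      PseudoParabolic.partialDeriv j v + PseudoParabolic.partialDeriv j w := by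
  ext x
  simp only [PseudoParabolic.partialDeriv, Pi.add_apply]
  rw [fderiv_add (hv.smooth.differentiable (by simp) x) (hw.smooth.differentiable (by simp) x)]
  rfl

theorem partialDeriv_smul (c : ℝ) (hv : IsTestFunction Ω v) (j : Fin d) :
    PseudoParabolic.partialDeriv j (c • v) = c • PseudoParabolic.partialDeriv j v := by
  ext x
  simp only [PseudoParabolic.partialDeriv, Pi.smul_apply]
  rw [fderiv_const_smul (hv.smooth.differentiable (by simp) x)]
  rfl

theorem integral_mul_partialDeriv (hv : IsTestFunction Ω v) (hw : IsTestFunction Ω w)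
    (j : Fin d) : inner ℝ hv.toL2 (hw.partialDeriv j).toL2 =
      - inner ℝ (hv.partialDeriv j).toL2 hw.toL2 := by
  have hconv : ∀ {a b : EuclideanSpace ℝ (Fin d) → ℝ} (ha : IsTestFunction Ω a)
      (hb : IsTestFunction Ω b), inner ℝ ha.toL2 hb.toL2 = ∫ x, a x * b x := by
    intro a b ha hb
    rw [← hb.integral_mul, ← setIntegral_eq_integral_of_forall_compl_eq_zero (s := Ω)
      (f := fun x => a x * b x) fun x hx => by rw [ha.eq_zero_of_notMem hx, zero_mul]]
    refine integral_congr_ae ?_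
    filter_upwards [ha.coeFn_toL2] with x hx
    rw [hx]
  have hint : ∀ {a b : EuclideanSpace ℝ (Fin d) → ℝ} (ha : IsTestFunction Ω a)
      (hb : IsTestFunction Ω b), Integrable fun x => a x * b x := fun ha hb =>
    (ha.smooth.continuous.mul hb.smooth.continuous).integrable_of_hasCompactSupport
      ha.compact.mul_right
  rw [hconv, hconv]
  exact integral_mul_fderiv_eq_neg_fderiv_mul_of_integrable (hint (hv.partialDeriv j) hw)
    (hint hv (hw.partialDeriv j)) (hint hv hw)
    (fun x _ => hv.smooth.differentiable (by simp) x)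
    (fun x _ => hw.smooth.differentiable (by simp) x)

end IsTestFunction

/-- The graph of the gradient on `C_c^∞(Ω)`, in `L²(Ω) × L²(Ω)^d`. -/
noncomputable def testGraph (Ω : Set (EuclideanSpace ℝ (Fin d))) :
    Submodule ℝ (WithLp 2 (L2 Ω × PiLp 2 fun _ : Fin d => L2 Ω)) where
  carrier := {p | ∃ (v : EuclideanSpace ℝ (Fin d) → ℝ) (hv : IsTestFunction Ω v), hv.toPair = p}
  add_mem' := by
    rintro _ _ ⟨v, hv, rfl⟩ ⟨w, hw, rfl⟩
    refine ⟨v + w, hv.add hw, ?_⟩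
    have h : ∀ j, ((hv.add hw).partialDeriv j).toL2 =
        (hv.partialDeriv j).toL2 + (hw.partialDeriv j).toL2 := fun j =>
      IsTestFunction.toL2_congr _ ((hv.partialDeriv j).add (hw.partialDeriv j))
        (hv.partialDeriv_add hw j)
    simp only [IsTestFunction.toPair, h]
    rfl
  zero_mem' := by
    refine ⟨0, IsTestFunction.zero, ?_⟩
    have h : ∀ j, ((IsTestFunction.zero (Ω := Ω)).partialDeriv j).toL2 = 0 := fun j =>
      IsTestFunction.toL2_congr _ IsTestFunction.zero (by ext x; simp [partialDeriv])
    simp only [IsTestFunction.toPair, h]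
    rfl
  smul_mem' := by
    rintro c _ ⟨v, hv, rfl⟩
    refine ⟨c • v, hv.smul c, ?_⟩
    have h : ∀ j, ((hv.smul c).partialDeriv j).toL2 = c • (hv.partialDeriv j).toL2 := fun j =>
      IsTestFunction.toL2_congr _ ((hv.partialDeriv j).smul c) (hv.partialDeriv_smul c j)
    simp only [IsTestFunction.toPair, h]
    rfl

/-- `W_0^{1,2}(Ω)` as the set of the pairs `(w, ∇w)`: the closure of the graph of the gradient. -/
noncomputable def sobolevGraph (Ω : Set (EuclideanSpace ℝ (Fin d))) :
    Submodule ℝ (WithLp 2 (L2 Ω × PiLp 2 fun _ : Fin d => L2 Ω)) :=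
  (testGraph Ω).topologicalClosure

theorem IsTestFunction.toPair_mem {v : EuclideanSpace ℝ (Fin d) → ℝ} (hv : IsTestFunction Ω v) :
    hv.toPair ∈ sobolevGraph Ω :=
  (testGraph Ω).le_topologicalClosure ⟨v, hv, rfl⟩

/-- By density, a closed condition need only be checked on test functions. -/
theorem sobolevGraph_induction {P : WithLp 2 (L2 Ω × PiLp 2 fun _ : Fin d => L2 Ω) → Prop}
    (hP : IsClosed {p | P p})
    (h : ∀ (v : EuclideanSpace ℝ (Fin d) → ℝ) (hv : IsTestFunction Ω v), P hv.toPair)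
    {p : WithLp 2 (L2 Ω × PiLp 2 fun _ : Fin d => L2 Ω)} (hp : p ∈ sobolevGraph Ω) : P p := by
  refine closure_minimal ?_ hP hp
  rintro _ ⟨v, hv, rfl⟩
  exact h v hv

theorem isWeakGradient_iff_inner {w : L2 Ω} {g : Fin d → L2 Ω} :
    IsWeakGradient Ω w g ↔ ∀ (v : EuclideanSpace ℝ (Fin d) → ℝ) (hv : IsTestFunction Ω v) (j),
      inner ℝ w (hv.partialDeriv j).toL2 = - inner ℝ (g j) hv.toL2 := by
  refine forall_congr' fun v => forall_congr' fun hv => forall_congr' fun j => ?_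
  rw [(hv.partialDeriv j).integral_mul, hv.integral_mul]

theorem isWeakGradient_of_mem_sobolevGraph
    {p : WithLp 2 (L2 Ω × PiLp 2 fun _ : Fin d => L2 Ω)} (hp : p ∈ sobolevGraph Ω) :
    IsWeakGradient Ω p.fst p.snd := by
  rw [isWeakGradient_iff_inner]
  intro v hv j
  refine sobolevGraph_induction (P := fun p => inner ℝ p.fst (hv.partialDeriv j).toL2 =
    - inner ℝ (p.snd j) hv.toL2) (isClosed_eq (by fun_prop) (by fun_prop)) ?_ hp
  intro w hw
  exact hw.integral_mul_partialDeriv hv j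

/-- The fundamental lemma of the calculus of variations. It gives uniqueness of weak gradients and
the density of test functions in L²(Ω). -/
theorem eq_zero_of_inner_test_eq_zero (hΩ : IsOpen Ω) {f : L2 Ω}
    (h : ∀ (v : EuclideanSpace ℝ (Fin d) → ℝ) (hv : IsTestFunction Ω v),
      inner ℝ f hv.toL2 = 0) : f = 0 := by
  have hloc : LocallyIntegrableOn f Ω := by
    rw [locallyIntegrableOn_iff hΩ.isLocallyClosed]
    intro K hK hKc
    have h1 : LocallyIntegrable f (volume.restrict Ω) := (Lp.memLp f).locallyIntegrable one_le_two
    have h2 := h1.integrableOn_isCompact hKc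
    rwa [IntegrableOn, Measure.restrict_restrict_of_subset hK] at h2
  have h0 := hΩ.ae_eq_zero_of_integral_contDiff_smul_eq_zero hloc fun g hg hgc hgs => by
    have := h g ⟨hg, hgc, hgs⟩
    rw [← IsTestFunction.integral_mul] at this
    rw [← this, ← setIntegral_eq_integral_of_forall_compl_eq_zero (s := Ω)
      fun x hx => by rw [image_eq_zero_of_notMem_tsupport fun hh => hx (hgs hh), zero_smul]]
    simp [mul_comm]
  rw [Lp.eq_zero_iff_ae_eq_zero]
  exact (ae_restrict_iff' hΩ.measurableSet).2 h0

theorem IsWeakGradient.unique (hΩ : IsOpen Ω) {w : L2 Ω} {g g' : Fin d → L2 Ω}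
    (hg : IsWeakGradient Ω w g) (hg' : IsWeakGradient Ω w g') : g = g' := by
  rw [isWeakGradient_iff_inner] at hg hg'
  ext1 j
  rw [← sub_eq_zero]
  refine eq_zero_of_inner_test_eq_zero hΩ fun v hv => ?_
  rw [inner_sub_left]
  linarith [hg v hv j, hg' v hv j]

theorem IsWeakGradient.weakGradient_eq (hΩ : IsOpen Ω) {w : L2 Ω} {g : Fin d → L2 Ω}
    (hg : IsWeakGradient Ω w g) : weakGradient Ω w = g := by
  have h : HasWeakGradient Ω w := ⟨g, hg⟩
  rw [weakGradient, dif_pos h]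
  exact h.choose_spec.unique hΩ hg

theorem tendsto_toL2_iff {v : ℕ → EuclideanSpace ℝ (Fin d) → ℝ} (hv : ∀ n, IsTestFunction Ω (v n))
    (w : L2 Ω) : Tendsto (fun n => (hv n).toL2) atTop (𝓝 w) ↔
      Tendsto (fun n => eLpNorm (fun x => v n x - w x) 2 (volume.restrict Ω)) atTop (𝓝 0) := by
  rw [Lp.tendsto_Lp_iff_tendsto_eLpNorm']
  refine tendsto_congr fun n => eLpNorm_congr_ae ?_
  filter_upwards [(hv n).coeFn_toL2] with x hx
  simp [hx]

theorem tendsto_pair_iff {q : ℕ → WithLp 2 (L2 Ω × PiLp 2 fun _ : Fin d => L2 Ω)}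
    {p : WithLp 2 (L2 Ω × PiLp 2 fun _ : Fin d => L2 Ω)} :
    Tendsto q atTop (𝓝 p) ↔ Tendsto (fun n => (q n).fst) atTop (𝓝 p.fst) ∧
      ∀ j, Tendsto (fun n => (q n).snd j) atTop (𝓝 (p.snd j)) := by
  constructor
  · intro h
    have hc : ∀ j, Continuous fun q : WithLp 2 (L2 Ω × PiLp 2 fun _ : Fin d => L2 Ω) => q.snd j :=
      fun j => by fun_prop
    exact ⟨((WithLp.continuous_fst ..).tendsto p).comp h, fun j => ((hc j).tendsto p).comp h⟩
  · rintro ⟨h1, h2⟩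
    have h3 : Tendsto (fun n => (WithLp.ofLp (q n).snd)) atTop (𝓝 (WithLp.ofLp p.snd)) :=
      tendsto_pi_nhds.2 h2
    have h4 := ((PiLp.continuous_toLp 2 fun _ : Fin d => L2 Ω).tendsto _).comp h3
    exact ((WithLp.prod_continuous_toLp 2 (L2 Ω) (PiLp 2 fun _ : Fin d => L2 Ω)).tendsto _).comp
      (h1.prodMk_nhds h4)

theorem MemW012.mem_sobolevGraph {w : L2 Ω} (hw : MemW012 Ω w) :
    WithLp.toLp 2 (w, WithLp.toLp 2 (weakGradient Ω w)) ∈ sobolevGraph Ω := by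
  obtain ⟨-, v, hv, h1, h2⟩ := hw
  have hlim : Tendsto (fun n => (hv n).toPair) atTop
      (𝓝 (WithLp.toLp 2 (w, WithLp.toLp 2 (weakGradient Ω w)))) := by
    rw [tendsto_pair_iff]
    exact ⟨(tendsto_toL2_iff hv w).2 h1,
      fun j => (tendsto_toL2_iff (fun n => (hv n).partialDeriv j) _).2 (h2 j)⟩
  exact mem_closure_of_tendsto hlim (Eventually.of_forall fun n => ⟨v n, hv n, rfl⟩)

theorem memW012_of_mem_sobolevGraph (hΩ : IsOpen Ω)
    {p : WithLp 2 (L2 Ω × PiLp 2 fun _ : Fin d => L2 Ω)} (hp : p ∈ sobolevGraph Ω) :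
    MemW012 Ω p.fst := by
  have hg := isWeakGradient_of_mem_sobolevGraph hp
  obtain ⟨q, hq, hlim⟩ := mem_closure_iff_seq_limit.1 hp
  choose v hv hvq using hq
  obtain rfl : (fun n => (hv n).toPair) = q := funext hvq
  rw [tendsto_pair_iff] at hlim
  refine ⟨⟨_, hg⟩, v, hv, (tendsto_toL2_iff hv _).1 hlim.1, fun j => ?_⟩
  rw [hg.weakGradient_eq hΩ]
  exact (tendsto_toL2_iff (fun n => (hv n).partialDeriv j) _).1 (hlim.2 j)

/-- Both sides are continuous in the pair, so the weak equation extends from C_c^∞ to W_0^{1,2};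
eigenfunctions can then be tested against each other. -/
theorem IsDirichletEigenfunction.inner_eq {l : ℝ} {f : L2 Ω} (hf : IsDirichletEigenfunction Ω l f)
    {p : WithLp 2 (L2 Ω × PiLp 2 fun _ : Fin d => L2 Ω)} (hp : p ∈ sobolevGraph Ω) :
    inner ℝ (WithLp.toLp 2 (weakGradient Ω f)) p.snd = l * inner ℝ f p.fst := by
  refine sobolevGraph_induction (P := fun p => inner ℝ (WithLp.toLp 2 (weakGradient Ω f)) p.snd =
    l * inner ℝ f p.fst) (isClosed_eq (by fun_prop) (by fun_prop)) (fun v hv => ?_) hp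
  have h := hf.eq v hv
  simp only [fun j => (hv.partialDeriv j).integral_mul, hv.integral_mul] at h
  rw [PiLp.inner_apply]
  exact h

end Sobolev

/-! ### Poincaré, Rellich, and existence of an eigensystem. -/

section Rellich

variable {d : ℕ} {Ω : Set (EuclideanSpace ℝ (Fin d))}

theorem ofReal_norm_sq_L2 {f : L2 Ω} {g : EuclideanSpace ℝ (Fin d) → ℝ}
    (h : f =ᵐ[volume.restrict Ω] g) :
    ENNReal.ofReal (‖f‖ ^ 2) = ∫⁻ x in Ω, ENNReal.ofReal (g x ^ 2) := by
  rw [← real_inner_self_eq_norm_sq, inner_L2_eq_integral]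
  have hint : Integrable (fun x => f x * f x) (volume.restrict Ω) :=
    (Lp.memLp f).integrable_mul (Lp.memLp f)
  rw [ofReal_integral_eq_lintegral_ofReal hint
    (Eventually.of_forall fun x => mul_self_nonneg _)]
  refine lintegral_congr_ae ?_
  filter_upwards [h] with x hx
  rw [hx, sq]

theorem IsTestFunction.ofReal_norm_sq {v : EuclideanSpace ℝ (Fin d) → ℝ}
    (hv : IsTestFunction Ω v) :
    ENNReal.ofReal (‖hv.toL2‖ ^ 2) = ∫⁻ x, ENNReal.ofReal (v x ^ 2) := by
  rw [ofReal_norm_sq_L2 hv.coeFn_toL2]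
  refine setLIntegral_eq_of_support_subset ?_
  intro x hx
  by_contra hxΩ
  simp [hv.eq_zero_of_notMem hxΩ] at hx

theorem IsTestFunction.ofReal_norm_sq_snd {v : EuclideanSpace ℝ (Fin d) → ℝ}
    (hv : IsTestFunction Ω v) :
    ENNReal.ofReal (‖hv.toPair.snd‖ ^ 2) =
      ∫⁻ x, ENNReal.ofReal (∑ j, PseudoParabolic.partialDeriv j v x ^ 2) := by
  have h1 : ‖hv.toPair.snd‖ ^ 2 = ∑ j, ‖(hv.partialDeriv j).toL2‖ ^ 2 :=
    PiLp.norm_sq_eq_of_L2 _ _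
  rw [h1, ENNReal.ofReal_sum_of_nonneg fun _ _ => by positivity]
  simp only [IsTestFunction.ofReal_norm_sq]
  rw [← lintegral_finsetSum]
  · refine lintegral_congr fun x => ?_
    rw [ENNReal.ofReal_sum_of_nonneg fun _ _ => by positivity]
  · intro j _
    exact ((hv.partialDeriv j).smooth.continuous.pow 2).measurable.ennreal_ofReal

theorem poincare (hd : 0 < d) {R : ℝ} (hR : Ω ⊆ Metric.ball 0 R)
    {p : WithLp 2 (L2 Ω × PiLp 2 fun _ : Fin d => L2 Ω)} (hp : p ∈ sobolevGraph Ω) :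
    ‖p.fst‖ ≤ 2 * |R| * ‖p.snd‖ := by
  refine sobolevGraph_induction (P := fun p => ‖p.fst‖ ≤ 2 * |R| * ‖p.snd‖)
    (isClosed_le (by fun_prop) (by fun_prop)) (fun v hv => ?_) hp
  have h := lintegral_sq_le_of_support_subset_ball hd (hv.smooth.of_le (by simp))
    (((subset_tsupport v).trans hv.support).trans hR)
  rw [← hv.ofReal_norm_sq, ← hv.ofReal_norm_sq_snd, ← ENNReal.ofReal_mul (by positivity),
    ENNReal.ofReal_le_ofReal_iff (by positivity), ← mul_pow] at h
  exact le_of_sq_le_sq h (by positivity)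

theorem exists_nearestPt_dist_le (hΩ : Bornology.IsBounded Ω) {r : ℝ} (hr : 0 < r) :
    ∃ (e : ℕ → EuclideanSpace ℝ (Fin d)) (N : ℕ), ∀ x ∈ Ω,
      dist (SimpleFunc.nearestPt e N x) x ≤ r := by
  let e := TopologicalSpace.denseSeq (EuclideanSpace ℝ (Fin d))
  obtain ⟨t, ht⟩ := hΩ.isCompact_closure.elim_finite_subcover (fun k => Metric.ball (e k) r)
    (fun k => Metric.isOpen_ball) fun x _ => by
      obtain ⟨k, hk⟩ := (TopologicalSpace.denseRange_denseSeq _).exists_dist_lt x hr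
      exact mem_iUnion.2 ⟨k, hk⟩
  refine ⟨e, t.sup id, fun x hx => ?_⟩
  obtain ⟨k, hk, hxk⟩ := mem_iUnion₂.1 (ht (subset_closure hx))
  have h := SimpleFunc.edist_nearestPt_le e x (Finset.le_sup (f := id) hk)
  rw [edist_dist, edist_dist, ENNReal.ofReal_le_ofReal_iff dist_nonneg] at h
  exact h.trans (by rw [dist_comm]; exact (Metric.mem_ball.1 hxk).le)

section StepFunction

variable {ι : Type*} [Fintype ι] [MeasurableSpace ι] [MeasurableSingletonClass ι]
  {i : EuclideanSpace ℝ (Fin d) → ι}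

theorem memLp_comp_of_finite (hΩ : Bornology.IsBounded Ω) (hi : Measurable i) (c : ι → ℝ) :
    MemLp (c ∘ i) 2 (volume.restrict Ω) :=
  have : IsFiniteMeasure (volume.restrict Ω) :=
    ⟨by rw [Measure.restrict_apply_univ]; exact hΩ.measure_lt_top⟩
  MemLp.of_bound ((measurable_of_countable c).comp hi).aestronglyMeasurable ‖c‖
    (Eventually.of_forall fun x => norm_le_pi_norm c (i x))

/-- The linear map that takes `c` to the class of the step function `c ∘ i` in `L²(Ω)`. -/
noncomputable def stepFunction (hΩ : Bornology.IsBounded Ω) (hi : Measurable i) :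
    (ι → ℝ) →ₗ[ℝ] L2 Ω where
  toFun c := (memLp_comp_of_finite hΩ hi c).toLp (c ∘ i)
  map_add' _ _ := rfl
  map_smul' _ _ := rfl

theorem coeFn_stepFunction (hΩ : Bornology.IsBounded Ω) (hi : Measurable i) (c : ι → ℝ) :
    stepFunction hΩ hi c =ᵐ[volume.restrict Ω] c ∘ i :=
  (memLp_comp_of_finite hΩ hi c).coeFn_toLp

end StepFunction

/-- Partition Ω by the nearest point of a finite r-net and replace v on each cell by its mean over
the ball around that point. These step functions span a finite-dimensional space, and the error is
at most a multiple of r‖∇v‖. -/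
theorem rellich_approx (hΩo : IsOpen Ω) (hΩ : Bornology.IsBounded Ω) {ε : ℝ} (hε : 0 < ε) :
    ∃ V : Submodule ℝ (L2 Ω), FiniteDimensional ℝ V ∧
      ∀ x ∈ testGraph Ω, ∃ v ∈ V, ‖x.fst - v‖ ≤ ε * ‖x‖ := by
  -- Then 2^d (2r)² = ε²/2^d ≤ ε², which absorbs the constant of `setLIntegral_sub_average_sq_le`.
  set r : ℝ := ε / (2 * 2 ^ d)
  have hr : 0 < r := by positivity
  have hrε : 2 ^ d * (2 * r) ^ 2 ≤ ε ^ 2 := by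
    have : (2 : ℝ) ^ d * (2 * r) ^ 2 = ε ^ 2 / 2 ^ d := by
      simp only [r]; field_simp
    rw [this]
    exact div_le_self (by positivity) (one_le_pow₀ one_le_two)
  obtain ⟨e, N, heN⟩ := exists_nearestPt_dist_le hΩ hr
  let i (x : EuclideanSpace ℝ (Fin d)) : Iic N :=
    ⟨SimpleFunc.nearestPtInd e N x, SimpleFunc.nearestPtInd_le e N x⟩
  have hi : Measurable i := (SimpleFunc.nearestPtInd e N).measurable.subtype_mk
  refine ⟨LinearMap.range (stepFunction hΩ hi), inferInstance, ?_⟩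
  rintro _ ⟨v, hv, rfl⟩
  let c (n : Iic N) : ℝ := ⨍ w in Metric.ball (e n) r, v w
  refine ⟨stepFunction hΩ hi c, ⟨c, rfl⟩, ?_⟩
  change ‖hv.toL2 - stepFunction hΩ hi c‖ ≤ ε * ‖hv.toPair‖
  have hae : ((hv.toL2 - stepFunction hΩ hi c : L2 Ω) : EuclideanSpace ℝ (Fin d) → ℝ)
      =ᵐ[volume.restrict Ω]
        fun x => v x - ⨍ w in Metric.ball (SimpleFunc.nearestPt e N x) r, v w := by
    filter_upwards [Lp.coeFn_sub hv.toL2 (stepFunction hΩ hi c), hv.coeFn_toL2,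
      coeFn_stepFunction hΩ hi c] with x h1 h2 h3
    rw [h1, Pi.sub_apply, h2, h3]
    rfl
  have h := setLIntegral_sub_average_sq_le (hv.smooth.of_le (by simp)) hr hΩo.measurableSet heN
  rw [← ofReal_norm_sq_L2 hae, ← hv.ofReal_norm_sq_snd, ← ENNReal.ofReal_mul (by positivity),
    ENNReal.ofReal_le_ofReal_iff (by positivity)] at h
  have hn : ‖hv.toPair.snd‖ ≤ ‖hv.toPair‖ := WithLp.norm_snd_le (L2 Ω) _
  refine le_of_sq_le_sq (h.trans ?_) (by positivity)
  rw [mul_pow ε]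
  gcongr

/-- Indicators of infinitely many disjoint open shells around a point of Ω are orthogonal and
nonzero. -/
theorem not_finiteDimensional_L2 (hd : 0 < d) (hΩ : IsOpen Ω) (hne : Ω.Nonempty)
    (hb : Bornology.IsBounded Ω) : ¬ FiniteDimensional ℝ (L2 Ω) := by
  intro hfin
  obtain ⟨x₀, hx₀⟩ := hne
  obtain ⟨ε, hε, hball⟩ := Metric.isOpen_iff.1 hΩ x₀ hx₀
  let A (n : ℕ) : Set (EuclideanSpace ℝ (Fin d)) :=
    {y | dist y x₀ ∈ Ioo (ε / (n + 2)) (ε / (n + 1))}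
  have hAo : ∀ n, IsOpen (A n) := fun n => isOpen_Ioo.preimage (by fun_prop)
  have hAΩ : ∀ n, A n ⊆ Ω := fun n y hy => hball (hy.2.trans_le
    (div_le_self hε.le (by linarith [n.cast_nonneg (α := ℝ)])))
  have hAne : ∀ n, (A n).Nonempty := by
    intro n
    have hlt : ε / (n + 2) < ε / (n + 1) := by gcongr; norm_num
    obtain ⟨c, hc⟩ := exists_between hlt
    have hc0 : 0 < c := lt_trans (by positivity) hc.1
    refine ⟨x₀ + EuclideanSpace.single ⟨0, hd⟩ c, ?_⟩
    simpa [A, abs_of_pos hc0] using hc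
  have hdisj : ∀ m n, m < n → A m ∩ A n = ∅ := by
    intro m n hmn
    ext y
    simp only [mem_inter_iff, mem_empty_iff_false, iff_false]
    rintro ⟨h1, h2⟩
    have h3 : ε / ((n : ℝ) + 1) ≤ ε / (m + 2) := by
      have : (m : ℝ) + 1 ≤ n := by exact_mod_cast hmn
      gcongr ε / ?_
      linarith
    exact absurd (h1.1.trans (h2.2.trans_le h3)) (lt_irrefl _)
  have hμ : ∀ n, volume.restrict Ω (A n) ≠ ⊤ := fun n =>
    ((Measure.restrict_apply_le _ _).trans_lt (hb.subset (hAΩ n)).measure_lt_top).ne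
  have hμ0 : ∀ n, (volume.restrict Ω).real (A n) ≠ 0 := by
    intro n
    rw [Measure.real, Measure.restrict_eq_self _ (hAΩ n)]
    exact (ENNReal.toReal_pos ((hAo n).measure_pos _ (hAne n)).ne'
      (hb.subset (hAΩ n)).measure_lt_top.ne).ne'
  let f (n : ℕ) : L2 Ω := indicatorConstLp 2 (hAo n).measurableSet (hμ n) (1 : ℝ)
  have hf : ∀ m n, inner ℝ (f m) (f n) = (volume.restrict Ω).real (A m ∩ A n) := fun m n =>
    L2.real_inner_indicatorConstLp_one_indicatorConstLp_one _ _ _ _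
  have hli : LinearIndependent ℝ f := by
    refine linearIndependent_of_ne_zero_of_inner_eq_zero (fun n h0 => hμ0 n ?_) fun m n hmn => ?_
    · rw [← inter_self (A n), ← hf, h0, inner_zero_left]
    · change inner ℝ (f m) (f n) = 0
      rw [hf]
      rcases lt_or_gt_of_ne hmn with h | h
      · rw [hdisj m n h]; simp
      · rw [inter_comm, hdisj n m h]; simp
  exact (inferInstance : Infinite ℕ).not_finite hli.finite_of_isNoetherian

theorem exists_isDirichletEigensystem (hd : 0 < d) (hΩ : IsOpen Ω) (hb : Bornology.IsBounded Ω)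
    (hne : Ω.Nonempty) :
    ∃ (θ : ℕ → ℝ) (φ : HilbertBasis ℕ ℝ (L2 Ω)), IsDirichletEigensystem Ω θ φ := by
  have hcomplete : CompleteSpace (sobolevGraph Ω) :=
    (testGraph Ω).isClosed_topologicalClosure.completeSpace_coe
  have : Fact ((2 : ENNReal) ≠ ⊤) := ⟨ENNReal.ofNat_ne_top⟩
  obtain ⟨l, φ, p, hp⟩ := exists_hilbertBasis_of_approx (not_finiteDimensional_L2 hd hΩ hne hb)
    (testGraph Ω) (WithLp.fstL 2 ℝ (L2 Ω) (PiLp 2 fun _ : Fin d => L2 Ω))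
    (fun ε hε => rellich_approx hΩ hb hε)
    fun f hf => eq_zero_of_inner_test_eq_zero hΩ fun v hv => hf hv.toPair ⟨v, hv, rfl⟩
  obtain ⟨R, hR⟩ := hb.subset_ball 0
  -- The graph inner product is ⟨w,w'⟩ + ⟨∇w,∇w'⟩; subtracting the L² term lowers the eigenvalue by
  -- 1.
  refine ⟨fun k => l k - 1, φ, ?_⟩
  have key : ∀ k, 0 < l k - 1 ∧ IsDirichletEigenfunction Ω (l k - 1) (φ k) := by
    intro k
    obtain ⟨hmem, hpfst, hin⟩ := hp k
    change (p k).fst = φ k at hpfst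
    have hnorm : ‖φ k‖ = 1 := φ.orthonormal.1 k
    have hφ0 : φ k ≠ 0 := fun h0 => by simp [h0] at hnorm
    have hsnd : ∀ q ∈ sobolevGraph Ω,
        inner ℝ (p k).snd q.snd = (l k - 1) * inner ℝ (φ k) q.fst := by
      intro q hq
      have h1 : inner ℝ (p k) q = l k * inner ℝ (φ k) q.fst := hin q hq
      have h2 : inner ℝ (p k) q = inner ℝ (p k).fst q.fst + inner ℝ (p k).snd q.snd :=
        WithLp.prod_inner_apply _ _
      rw [hpfst] at h2
      linarith
    have hgrad := (isWeakGradient_of_mem_sobolevGraph hmem).weakGradient_eq hΩ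
    rw [hpfst] at hgrad
    refine ⟨?_, hφ0, hpfst ▸ memW012_of_mem_sobolevGraph hΩ hmem, fun v hv => ?_⟩
    · have h1 := hsnd _ hmem
      rw [real_inner_self_eq_norm_sq, hpfst, real_inner_self_eq_norm_sq, hnorm] at h1
      have h2 := poincare hd hR hmem
      rw [hpfst, hnorm] at h2
      have h3 : ‖(p k).snd‖ ≠ 0 := by
        intro h0
        rw [h0] at h2
        linarith
      have h4 := pow_pos (lt_of_le_of_ne (norm_nonneg _) h3.symm) 2
      linarith
    · have h1 := hsnd _ hv.toPair_mem
      simp only [fun (j : Fin d) (f : L2 Ω) => (hv.partialDeriv j).integral_mul f,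
        hv.integral_mul, hgrad]
      rw [PiLp.inner_apply] at h1
      exact h1
  exact ⟨fun k => (key k).1, fun k => (key k).2⟩

end Rellich

/-! ### The gradient and the scale D^1 in terms of an eigensystem. -/

open scoped BoundedContinuousFunction

theorem _root_.HilbertBasis.exists_linearIsometry {H X : Type*} [NormedAddCommGroup H]
    [InnerProductSpace ℝ H] [NormedAddCommGroup X] [InnerProductSpace ℝ X] [CompleteSpace X]
    (φ : HilbertBasis ℕ ℝ H) {ψ : ℕ → X} (hψ : Orthonormal ℝ ψ) :
    ∃ V : H →ₗᵢ[ℝ] X, ∀ k, V (φ k) = ψ k := by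
  classical
  refine ⟨hψ.orthogonalFamily.linearIsometry.comp φ.repr.toLinearIsometry, fun k => ?_⟩
  change hψ.orthogonalFamily.linearIsometry (φ.repr (φ k)) = ψ k
  rw [φ.repr_self, OrthogonalFamily.linearIsometry_apply_single]
  simp

section Eigensystem

variable {d : ℕ} {Ω : Set (EuclideanSpace ℝ (Fin d))} {θ : ℕ → ℝ} {φ : HilbertBasis ℕ ℝ (L2 Ω)}

theorem IsDirichletEigensystem.inner_weakGradient (h : IsDirichletEigensystem Ω θ φ) (k l : ℕ) :
    inner ℝ (WithLp.toLp 2 (weakGradient Ω (φ k)) : PiLp 2 fun _ : Fin d => L2 Ω)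
      (WithLp.toLp 2 (weakGradient Ω (φ l))) = θ k * inner ℝ (φ k) (φ l) :=
  (h.eigen k).inner_eq (h.eigen l).mem.mem_sobolevGraph

/-- Poincaré for φ_k, where ‖φ_k‖ = 1 and ‖∇φ_k‖ = √θ_k. -/
theorem IsDirichletEigensystem.exists_inv_sqrt_le (h : IsDirichletEigensystem Ω θ φ) (hd : 0 < d)
    (hb : Bornology.IsBounded Ω) : ∃ C : ℝ, ∀ k, (√(θ k))⁻¹ ≤ C := by
  obtain ⟨R, hR⟩ := hb.subset_ball 0
  refine ⟨2 * |R|, fun k => ?_⟩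
  have hP := poincare hd hR (h.eigen k).mem.mem_sobolevGraph
  have hn : ‖φ k‖ = 1 := φ.orthonormal.1 k
  have hg : ‖(WithLp.toLp 2 (weakGradient Ω (φ k)) : PiLp 2 fun _ : Fin d => L2 Ω)‖ =
      √(θ k) := by
    rw [norm_eq_sqrt_real_inner, h.inner_weakGradient, real_inner_self_eq_norm_sq, hn]
    simp
  change ‖φ k‖ ≤ 2 * |R| *
    ‖(WithLp.toLp 2 (weakGradient Ω (φ k)) : PiLp 2 fun _ : Fin d => L2 Ω)‖ at hP
  rw [hn, hg] at hP
  have := Real.sqrt_pos.2 (h.pos k)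
  rwa [inv_le_iff_one_le_mul₀ this]

/-- The vectors θ_k^(-1/2)∇φ_k are orthonormal, so φ_k ↦ θ_k^(-1/2)∇φ_k extends to an isometry.
Tested against a fixed v, the weak gradient identity is an equality of bounded functionals of x, and
it suffices to check it on the basis. -/
theorem IsDirichletEigensystem.exists_gradient_isometry (h : IsDirichletEigensystem Ω θ φ)
    {b : ℕ →ᵇ ℝ} (hb : ∀ k, b k = (√(θ k))⁻¹) :
    ∃ V : L2 Ω →ₗᵢ[ℝ] PiLp 2 fun _ : Fin d => L2 Ω,
      ∀ x, IsWeakGradient Ω (φ.diagonal b x) (V x) := by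
  let ψ (k : ℕ) : PiLp 2 fun _ : Fin d => L2 Ω :=
    (√(θ k))⁻¹ • WithLp.toLp 2 (weakGradient Ω (φ k))
  have hψ : Orthonormal ℝ ψ := by
    rw [orthonormal_iff_ite]
    intro k l
    have hs := (Real.sqrt_pos.2 (h.pos k)).ne'
    rw [real_inner_smul_left, real_inner_smul_right, h.inner_weakGradient,
      orthonormal_iff_ite.1 φ.orthonormal]
    split_ifs with hkl
    · subst hkl
      nth_rw 3 [← Real.mul_self_sqrt (h.pos k).le]
      field_simp
    · simp
  obtain ⟨V, hV⟩ := φ.exists_linearIsometry hψ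
  refine ⟨V, fun x => isWeakGradient_iff_inner.2 fun v hv j => ?_⟩
  let f₁ : L2 Ω →L[ℝ] ℝ := (innerSL ℝ (hv.partialDeriv j).toL2) ∘L φ.diagonal b
  let f₂ : L2 Ω →L[ℝ] ℝ := -((innerSL ℝ hv.toL2) ∘L
    (PiLp.proj 2 (fun _ : Fin d => L2 Ω) j ∘L V.toContinuousLinearMap))
  have hdiag : ∀ k, φ.diagonal b (φ k) = (√(θ k))⁻¹ • φ k := by
    intro k
    refine φ.ext_inner fun l => ?_
    rw [φ.inner_diagonal, real_inner_smul_left, orthonormal_iff_ite.1 φ.orthonormal, hb]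
    split_ifs with hkl
    · rw [hkl]
    · simp
  have hf : f₁ = f₂ := by
    refine ContinuousLinearMap.ext_on
      (s := range φ) (Submodule.dense_iff_topologicalClosure_eq_top.2 φ.dense_span) ?_
    rintro _ ⟨k, rfl⟩
    have hw : IsWeakGradient Ω (φ k) (weakGradient Ω (φ k)) :=
      isWeakGradient_of_mem_sobolevGraph (h.eigen k).mem.mem_sobolevGraph
    have := isWeakGradient_iff_inner.1 hw v hv j
    change inner ℝ (hv.partialDeriv j).toL2 (φ.diagonal b (φ k)) = -inner ℝ hv.toL2 (V (φ k) j)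
    rw [hdiag, hV, real_inner_smul_right, real_inner_comm, this]
    change _ = -inner ℝ hv.toL2 ((√(θ k))⁻¹ • weakGradient Ω (φ k) j)
    rw [real_inner_smul_right, real_inner_comm]
    ring
  have := congrArg (fun f : L2 Ω →L[ℝ] ℝ => f x) hf
  change inner ℝ (hv.partialDeriv j).toL2 (φ.diagonal b x) = -inner ℝ hv.toL2 (V x j) at this
  rw [real_inner_comm, this, real_inner_comm]

section Scale

variable {b : ℕ →ᵇ ℝ}

theorem hasSum_normD_diagonal (hθ : ∀ k, 0 < θ k) (hb : ∀ k, b k = (√(θ k))⁻¹) (x : L2 Ω) :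
    HasSum (fun k => θ k ^ (1 : ℝ) * inner ℝ (φ.diagonal b x) (φ k) ^ 2) (‖x‖ ^ 2) := by
  refine (φ.hasSum_sq_inner x).congr_fun fun k => ?_
  have hs := Real.sqrt_pos.2 (hθ k)
  rw [φ.inner_diagonal, hb, Real.rpow_one, mul_pow, inv_pow, Real.sq_sqrt (hθ k).le, ← mul_assoc,
    mul_inv_cancel₀ (hθ k).ne', one_mul]

theorem memD_diagonal (hθ : ∀ k, 0 < θ k) (hb : ∀ k, b k = (√(θ k))⁻¹) (x : L2 Ω) :
    MemD θ φ 1 (φ.diagonal b x) :=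
  (hasSum_normD_diagonal hθ hb x).summable

theorem normD_diagonal (hθ : ∀ k, 0 < θ k) (hb : ∀ k, b k = (√(θ k))⁻¹) (x : L2 Ω) :
    normD θ φ 1 (φ.diagonal b x) = ‖x‖ := by
  rw [normD, (hasSum_normD_diagonal hθ hb x).tsum_eq, Real.sqrt_sq (norm_nonneg x)]

theorem exists_diagonal_eq (hθ : ∀ k, 0 < θ k) (hb : ∀ k, b k = (√(θ k))⁻¹) {w : L2 Ω}
    (hw : MemD θ φ 1 w) : ∃ x, φ.diagonal b x = w := by
  have hsum : Summable fun k => (√(θ k) * inner ℝ w (φ k)) ^ 2 := by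
    refine hw.congr fun k => ?_
    rw [mul_pow, Real.sq_sqrt (hθ k).le, Real.rpow_one]
  obtain ⟨x, hx⟩ := φ.exists_inner_eq hsum
  refine ⟨x, φ.ext_inner fun k => ?_⟩
  rw [φ.inner_diagonal, hx, hb, ← mul_assoc, inv_mul_cancel₀ (Real.sqrt_pos.2 (hθ k)).ne', one_mul]

theorem continuousIntoD1_of_eqOn (hθ : ∀ k, 0 < θ k) (hb : ∀ k, b k = (√(θ k))⁻¹) {T : ℝ}
    {u x : ℝ → L2 Ω} (hx : ContinuousOn x (Icc 0 T)) (hu : ∀ t ∈ Icc 0 T, u t = φ.diagonal b (x t)) :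
    ContinuousIntoD1 θ φ T u := by
  refine ⟨fun t ht => hu t ht ▸ memD_diagonal hθ hb _, fun t ht => ?_⟩
  refine (tendsto_iff_norm_sub_tendsto_zero.1 (hx t ht)).congr' ?_
  filter_upwards [self_mem_nhdsWithin] with s hs
  rw [hu s hs, hu t ht, ← map_sub, normD_diagonal hθ hb]

theorem weight_le {α T : ℝ} (hα : 0 < α) {t : ℝ} (ht : t ∈ Ioc 0 T) :
    t ^ α * Real.exp (-1 * t) ≤ T ^ α := by
  have h1 : Real.exp (-1 * t) ≤ 1 := Real.exp_le_one_iff.2 (by linarith [ht.1])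
  have h2 : t ^ α ≤ T ^ α := Real.rpow_le_rpow ht.1.le ht.2 hα.le
  have h3 : 0 ≤ T ^ α := Real.rpow_nonneg (ht.1.le.trans ht.2) _
  calc t ^ α * Real.exp (-1 * t) ≤ T ^ α * 1 := by gcongr
    _ = _ := mul_one _

theorem memWeighted_of_eqOn (hθ : ∀ k, 0 < θ k) (hb : ∀ k, b k = (√(θ k))⁻¹) {α T : ℝ}
    (hα : 0 < α) (hT : 0 < T) {u x : ℝ → L2 Ω} (hx : ContinuousOn x (Icc 0 T))
    (hu : ∀ t ∈ Icc 0 T, u t = φ.diagonal b (x t)) {u₀ : L2 Ω} (h0 : u 0 = u₀) :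
    MemWeighted θ φ α 1 u₀ T u := by
  refine ⟨continuousIntoD1_of_eqOn hθ hb hx hu, ?_, h0⟩
  obtain ⟨M, hM⟩ := isCompact_Icc.exists_bound_of_continuousOn hx
  refine ⟨T ^ α * M, fun t ht => ?_⟩
  rw [hu t ⟨ht.1.le, ht.2⟩, normD_diagonal hθ hb]
  have := weight_le hα ht
  have := hM t ⟨ht.1.le, ht.2⟩
  gcongr

end Scale

end Eigensystem

/-! ### The solution operators as diagonal operators. -/

theorem mittagLeffler_one_zero (a : ℝ) : mittagLeffler a 1 0 = 1 := by
  rw [mittagLeffler, tsum_eq_single 0 fun n hn => by rw [zero_pow hn, zero_div]]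
  simp

/-- The curve `t ↦ (l ↦ E_{α,b}(-l t^α))` of continuous functions on the unit interval. -/
noncomputable def mittagLefflerCurve {α b : ℝ} (hα : 0 < α) (hb : 0 < b) :
    C(ℝ, C(unitInterval, ℝ)) :=
  ContinuousMap.curry ⟨fun p => mittagLeffler α b (-(p.2 : ℝ) * p.1 ^ α), by
    refine (continuous_mittagLeffler hα hb).comp (Continuous.mul (by fun_prop) ?_)
    exact (Real.continuous_rpow_const hα.le).comp continuous_fst⟩

theorem mittagLefflerCurve_apply {α b : ℝ} (hα : 0 < α) (hb : 0 < b) (t : ℝ) (l : unitInterval) :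
    mittagLefflerCurve hα hb t l = mittagLeffler α b (-(l : ℝ) * t ^ α) := rfl

section Operators

variable {d : ℕ} {Ω : Set (EuclideanSpace ℝ (Fin d))} {θ : ℕ → ℝ} {φ : HilbertBasis ℕ ℝ (L2 Ω)}
  {b n : ℕ →ᵇ ℝ} {l : ℕ → unitInterval} {α : ℝ}

theorem opS_eq_diagonal (hl : ∀ k, (l k : ℝ) = θ k / (1 + θ k)) (hα : 0 < α) (t : ℝ) (w : L2 Ω) :
    opS θ φ α t w = φ.diagonal (symbol l (mittagLefflerCurve hα one_pos t)) w := by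
  rw [opS, ← φ.tsum_smul_eq_diagonal]
  refine tsum_congr fun k => ?_
  rw [symbol_apply, mittagLefflerCurve_apply, hl]
  congr 4
  ring

/-- The factor 1/(1+θ) is split into θ^(-1/2), which maps L² onto D^1, and the bounded remainder
√θ/(1+θ). -/
theorem opR_eq_diagonal (hθ : ∀ k, 0 < θ k) (hb : ∀ k, b k = (√(θ k))⁻¹)
    (hn : ∀ k, n k = √(θ k) / (1 + θ k))
    (hl : ∀ k, (l k : ℝ) = θ k / (1 + θ k)) (hα : 0 < α) (s : ℝ) (w : L2 Ω) :
    opR θ φ α s w = φ.diagonal b (s ^ (α - 1) •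
      φ.diagonal (n * symbol l (mittagLefflerCurve hα hα s)) w) := by
  rw [map_smul, φ.diagonal_diagonal, ← smul_apply, ← map_smul, opR, ← φ.tsum_smul_eq_diagonal]
  refine tsum_congr fun k => ?_
  have hs := (Real.sqrt_pos.2 (hθ k)).ne'
  have hθk : 1 + θ k ≠ 0 := by linarith [hθ k]
  have harg : -θ k * s ^ α / (1 + θ k) = -(l k : ℝ) * s ^ α := by rw [hl]; ring
  rw [harg]
  simp only [BoundedContinuousFunction.smul_apply, BoundedContinuousFunction.mul_apply,
    symbol_apply, mittagLefflerCurve_apply, hb, hn, smul_eq_mul]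
  congr 1
  field_simp

theorem continuous_diagonal_symbol (φ : HilbertBasis ℕ ℝ (L2 Ω)) (n : ℕ →ᵇ ℝ)
    (l : ℕ → unitInterval) (f : C(ℝ, C(unitInterval, ℝ))) :
    Continuous fun t => φ.diagonal (n * symbol l (f t)) :=
  φ.diagonal.continuous.comp (continuous_const.mul ((continuous_symbol l).comp f.continuous))

end Operators

theorem exists_boundedContinuous {f : ℕ → ℝ} {C : ℝ} (hf : ∀ k, ‖f k‖ ≤ C) :
    ∃ g : ℕ →ᵇ ℝ, ∀ k, g k = f k :=
  ⟨BoundedContinuousFunction.ofNormedAddCommGroupDiscrete f C hf, fun _ => rfl⟩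

theorem IsDirichletEigensystem.exists_symbols {d : ℕ} {Ω : Set (EuclideanSpace ℝ (Fin d))}
    {θ : ℕ → ℝ} {φ : HilbertBasis ℕ ℝ (L2 Ω)} (h : IsDirichletEigensystem Ω θ φ) (hd : 0 < d)
    (hΩ : Bornology.IsBounded Ω) :
    ∃ (b n : ℕ →ᵇ ℝ) (l : ℕ → unitInterval), (∀ k, b k = (√(θ k))⁻¹) ∧
      (∀ k, n k = √(θ k) / (1 + θ k)) ∧ ∀ k, (l k : ℝ) = θ k / (1 + θ k) := by
  obtain ⟨C, hC⟩ := h.exists_inv_sqrt_le hd hΩ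
  obtain ⟨b, hb⟩ := exists_boundedContinuous (f := fun k => (√(θ k))⁻¹) (C := C) fun k => by
    rw [Real.norm_of_nonneg (by positivity)]
    exact hC k
  obtain ⟨n, hn⟩ := exists_boundedContinuous (f := fun k => √(θ k) / (1 + θ k)) (C := 1) fun k => by
    have hθ := h.pos k
    rw [Real.norm_of_nonneg (by positivity), div_le_one (by positivity)]
    nlinarith [Real.sq_sqrt hθ.le, sq_nonneg (√(θ k) - 1)]
  refine ⟨b, n, fun k => ⟨θ k / (1 + θ k), ?_, ?_⟩, hb, hn, fun k => rfl⟩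
  · have hθ := h.pos k
    positivity
  · have hθ := h.pos k
    rw [div_le_one (by positivity)]
    linarith

theorem advection_eq {d : ℕ} {Ω : Set (EuclideanSpace ℝ (Fin d))} (hΩ : IsOpen Ω)
    (η : EuclideanSpace ℝ (Fin d)) {B : L2 Ω →L[ℝ] L2 Ω}
    {V : L2 Ω →ₗᵢ[ℝ] PiLp 2 fun _ : Fin d => L2 Ω} (hV : ∀ x, IsWeakGradient Ω (B x) (V x)) :
    ∃ G : L2 Ω →L[ℝ] L2 Ω, ∀ x, advection η (B x) = G x := by
  refine ⟨∑ j, η j • (PiLp.proj 2 (fun _ : Fin d => L2 Ω) j ∘L V.toContinuousLinearMap),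
    fun x => ?_⟩
  rw [advection, (hV x).weakGradient_eq hΩ]
  simp

end PseudoParabolic

/-! ### The main theorem, by transport to L²(Ω). -/

theorem mainTheorem1 {d : ℕ} (hd : 0 < d) (Ω : Set (EuclideanSpace ℝ (Fin d)))
    (hΩ_open : IsOpen Ω) (hΩ_bdd : Bornology.IsBounded Ω) (hΩ_ne : Ω.Nonempty)
    (α : ℝ) (hα : α ∈ Ioo (0 : ℝ) 1) (η : EuclideanSpace ℝ (Fin d)) :
    (∃ (θ : ℕ → ℝ) (φ : HilbertBasis ℕ ℝ (L2 Ω)), IsDirichletEigensystem Ω θ φ) ∧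
    ∀ (θ : ℕ → ℝ) (φ : HilbertBasis ℕ ℝ (L2 Ω)), IsDirichletEigensystem Ω θ φ →
      -- the source is well defined and globally Lipschitz from `D^1(Ω)` to `L²(Ω)`
      (∀ w : L2 Ω, MemD θ φ 1 w → HasWeakGradient Ω w) ∧
      (∃ C : ℝ, 0 < C ∧ ∀ w v : L2 Ω, MemD θ φ 1 w → MemD θ φ 1 v →
        ‖advection η w - advection η v‖ ≤ C * normD θ φ 1 (w - v)) ∧
      -- global existence, the solution being the limit of the Picard iterates
      ∀ u₀ : L2 Ω, MemD θ φ 1 u₀ → ∀ T : ℝ, 0 < T →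
        ∃ u : ℝ → L2 Ω, IsMildSolution θ φ α η u₀ T u ∧
          ∃ σ : ℝ, 0 < σ ∧ MemWeighted θ φ α σ u₀ T u ∧
            (∀ n, MemWeighted θ φ α σ u₀ T (picard θ φ α η u₀ n)) ∧
            ∀ ε : ℝ, 0 < ε → ∃ N : ℕ, ∀ n ≥ N, ∀ t ∈ Ioc 0 T,
              t ^ α * Real.exp (-σ * t) * normD θ φ 1 (picard θ φ α η u₀ n t - u t) ≤ ε := by
  refine ⟨exists_isDirichletEigensystem hd hΩ_open hΩ_bdd hΩ_ne, fun θ φ h => ?_⟩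
  have hα0 : 0 < α := hα.1
  obtain ⟨b, n, l, hb, hn, hl⟩ := h.exists_symbols hd hΩ_bdd
  have hθ := h.pos
  obtain ⟨V, hV⟩ := h.exists_gradient_isometry hb
  obtain ⟨G, hG⟩ := advection_eq hΩ_open η hV
  refine ⟨fun w hw => ?_, ⟨‖G‖ + 1, by positivity, fun w v hw hv => ?_⟩, fun u₀ hu₀ T hT => ?_⟩
  · obtain ⟨x, rfl⟩ := exists_diagonal_eq hθ hb hw
    exact ⟨_, hV x⟩
  · obtain ⟨x, rfl⟩ := exists_diagonal_eq hθ hb hw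
    obtain ⟨y, rfl⟩ := exists_diagonal_eq hθ hb hv
    rw [hG, hG, ← map_sub, ← map_sub, normD_diagonal hθ hb]
    refine (G.le_opNorm _).trans ?_
    gcongr
    linarith
  obtain ⟨x₀, rfl⟩ := exists_diagonal_eq hθ hb hu₀
  let k (s : ℝ) : L2 Ω →L[ℝ] L2 Ω :=
    φ.diagonal (n * symbol l (mittagLefflerCurve hα0 hα0 s)) ∘L G
  have hk : Continuous k :=
    (continuous_diagonal_symbol φ n l (mittagLefflerCurve hα0 hα0)).clm_comp continuous_const
  let f (t : ℝ) : L2 Ω := φ.diagonal (1 * symbol l (mittagLefflerCurve hα0 one_pos t)) x₀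
  have hf : Continuous f :=
    (continuous_diagonal_symbol φ 1 l (mittagLefflerCurve hα0 one_pos)).clm_apply continuous_const
  have hS : ∀ t, opS θ φ α t (φ.diagonal b x₀) = φ.diagonal b (f t) := by
    intro t
    simp only [f]
    rw [opS_eq_diagonal hl hα0, φ.diagonal_diagonal, φ.diagonal_diagonal, one_mul, mul_comm]
  have hR : ∀ s x, opR θ φ α s (advection η (φ.diagonal b x)) =
      φ.diagonal b (s ^ (α - 1) • k s x) := by
    intro s x
    rw [hG, opR_eq_diagonal hθ hb hn hl hα0]
    rfl
  -- The bounded operator B commutes with the Bochner integral. This one identity converts both the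
  -- mild equation and the Picard recursion into their Volterra forms.
  have hint : ∀ {u x : ℝ → L2 Ω} {t : ℝ}, 0 ≤ t → ContinuousOn x (Icc 0 t) →
      (∀ s ∈ Icc 0 t, u s = φ.diagonal b (x s)) →
      IntervalIntegrable (fun τ => opR θ φ α (t - τ) (advection η (u τ))) volume 0 t ∧
      opS θ φ α t (φ.diagonal b x₀) + ∫ τ in (0 : ℝ)..t, opR θ φ α (t - τ) (advection η (u τ)) =
        φ.diagonal b (f t + volterra α k x t) := by
    intro u x t ht hx hu
    have hi := intervalIntegrable_volterra hα0 hk ht hx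
    have heq : ∀ τ ∈ uIcc 0 t, opR θ φ α (t - τ) (advection η (u τ)) =
        φ.diagonal b ((t - τ) ^ (α - 1) • k (t - τ) (x τ)) := by
      intro τ hτ
      rw [uIcc_of_le ht] at hτ
      rw [hu τ hτ, hR]
    constructor
    · refine IntervalIntegrable.congr (fun τ hτ => (heq τ (uIoc_subset_uIcc hτ)).symm) ?_
      exact ⟨(φ.diagonal b).integrable_comp hi.1, (φ.diagonal b).integrable_comp hi.2⟩
    · rw [intervalIntegral.integral_congr heq, (φ.diagonal b).intervalIntegral_comp_comm hi, hS,
        map_add]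
      rfl
  have hIcc : ∀ {t s : ℝ}, t ∈ Icc 0 T → s ∈ Icc 0 t → s ∈ Icc 0 T := fun ht hs =>
    ⟨hs.1, hs.2.trans ht.2⟩
  have hpicard : ∀ m, ∀ t ∈ Icc 0 T, picard θ φ α η (φ.diagonal b x₀) m t =
      φ.diagonal b (volterraIter α k f m t) := by
    intro m
    induction m with
    | zero => exact fun t _ => hS t
    | succ m ih =>
      exact fun t ht => (hint ht.1 ((continuousOn_volterraIter hα0 hT hk hf m).mono
        fun s hs => hIcc ht hs) fun s hs => ih s (hIcc ht hs)).2
  obtain ⟨x, hxc, hx, hlim⟩ := exists_volterra_solution hα0 hT hk hf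
  have hzero : ∀ t : ℝ, t = 0 → φ.diagonal b (f t) = φ.diagonal b x₀ := by
    rintro _ rfl
    congr 1
    refine φ.ext_inner fun j => ?_
    simp [f, φ.inner_diagonal, symbol_apply, mittagLefflerCurve_apply, Real.zero_rpow hα0.ne',
      mittagLeffler_one_zero]
  have h0T : (0 : ℝ) ∈ Icc 0 T := ⟨le_rfl, hT.le⟩
  have hx0 : φ.diagonal b (x 0) = φ.diagonal b x₀ := by
    rw [hx 0 h0T]
    simpa [volterra] using hzero 0 rfl
  -- The choice σ = 1 is arbitrary: the convergence is already uniform on [0,T], and the weight is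
  -- at most T^α there. The large σ of the contraction stays inside `exists_volterra_solution`.
  refine ⟨fun t => φ.diagonal b (x t), ⟨?_, hx0, fun t _ => ⟨_, hV _⟩, fun t ht => ?_,
    fun t ht => ?_⟩, 1, one_pos, ?_, fun m => ?_, fun ε hε => ?_⟩
  · exact continuousIntoD1_of_eqOn hθ hb hxc.continuousOn fun _ _ => rfl
  · exact (hint ht.1 hxc.continuousOn fun _ _ => rfl).1
  · rw [(hint ht.1 hxc.continuousOn fun _ _ => rfl).2, ← hx t ht]
  · exact memWeighted_of_eqOn hθ hb hα0 hT hxc.continuousOn (fun _ _ => rfl) hx0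
  · refine memWeighted_of_eqOn hθ hb hα0 hT (continuousOn_volterraIter hα0 hT hk hf m)
      (hpicard m) ?_
    rw [hpicard m 0 h0T]
    cases m with
    | zero => exact hzero 0 rfl
    | succ m => simpa [volterraIter, volterra] using hzero 0 rfl
  · have hTα : 0 < T ^ α := Real.rpow_pos_of_pos hT α
    obtain ⟨N, hN⟩ := hlim (ε / T ^ α) (by positivity)
    refine ⟨N, fun m hm t ht => ?_⟩
    have htI : t ∈ Icc 0 T := ⟨ht.1.le, ht.2⟩
    rw [hpicard m t htI, ← map_sub, normD_diagonal hθ hb]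
    calc _ ≤ T ^ α * (ε / T ^ α) := by
          have h1 := weight_le hα0 ht
          have h2 := hN m hm t htI
          gcongr
      _ = ε := mul_div_cancel₀ ε hTα.ne'
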